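/- **Model.** Let $R\ge 1$ and let $x_1\neq x_2$ be two stress levels. Let $0=IT_0<IT_1<\dots<IT_L=\tau_2$ be inspection times that contain the time $\tau_1\in(0,\tau_2)$ of stress change. For a parameter $a=(a_{0j},a_{1j})_{j=1,\dots,R}\in\mathbb R^{2R}$ put $\theta_{ij}=\exp(a_{0j}+a_{1j}x_i)$, $h^{(1)}_j=0$ and $h^{(2)}_j=\tau_1(\theta_{2j}/\theta_{1j}-1)$. Under the simple step-stress model with independent competing exponential risks (cumulative exposure model), the latent lifetime of risk $j$ has CDF $F_j(t)=1-e^{-(t+h^{(1)}_j)/\theta_{1j}}$ for $0<t<\tau_1$, $F_j(t)=1-e^{-(t+h^{(2)}_j)/\theta_{2j}}$ for $t\ge\tau_1$, and $F_j(t)=0$ for $t\le0$. The $R$ latent lifetimes of a unit are independent; a unit fails at the smallest of them, from the cause that attains it. For $N$ independent units with true parameter $a_0$ one observes the numbers $n_{lj}$ of failures in $(IT_{l-1},IT_l]$ from cause $j$ and the number $n_0$ of survivors beyond $\tau_2$; $\hat p$ is the vector of the $n_{lj}/N$ and $n_0/N$. Put $$\pi_{ij}=\frac{\theta_{ij}^{-1}}{\sum_{k}\theta_{ik}^{-1}},\qquad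 S_i(t)=\exp\Big(-\sum_k\frac{t+h_k^{(i)}}{\theta_{ik}}\Big),\qquad p_{lj}(a)=\pi_{ij}\big(S_i(IT_{l-1})-S_i(IT_l)\big),\qquad p_0(a)=S_2(\tau_2),$$ where $i=1$ if $IT_l\le\tau_1$ and $i=2$ otherwise, and let $p(a)$ be the vector of these $RL+1$ probabilities. **Estimator.** For $\beta>0$ let $$d_\beta(q,p)=\sum_c\Big(p_c^{1+\beta}-\big(1+\tfrac1\beta\big)q_cp_c^{\beta}+\tfrac1\beta q_c^{1+\beta}\Big),$$ the sum running over all $RL+1$ cells, and let $d_0(q,p)=\sum_c q_c\log(q_c/p_c)$. For $\beta\ge0$ the minimum density power divergence estimator (MDPDE) $\hat a^\beta=\hat a^\beta_N$ is a random vector that minimises $a\mapsto d_\beta(\hat p,p(a))$ over $\mathbb R^{2R}$ whenever a minimiser exists and at least one failure has been observed for each combination of stress level and cause. **Covariance.** Let $h^{*(1)}_k=0$ and $h^{*(2)}_k=\tau_1\frac{\theta_{2k}}{\theta_{1k}}(x_2-x_1)$. For an interval with stress level $i$ and $t\in\{IT_{l-1},IT_l\}$, let $z_j^k(t)$ be the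 row vector with the two entries $$\pi_{ij}S_i(t)\Big(\pi_{ik}-\delta_{jk}+\frac{t+h_k^{(i)}}{\theta_{ik}}\Big),\qquad \pi_{ij}S_i(t)\Big((\pi_{ik}-\delta_{jk})x_i+\frac{-h^{*(i)}_k+(t+h_k^{(i)})x_i}{\theta_{ik}}\Big).$$ Let $W=W(a)$ be the $(RL+1)\times 2R$ matrix whose $k$-th $1\times2$ block is $z_j^k(IT_{l-1})-z_j^k(IT_l)$ in the row $(l,j)$ and $$S_2(\tau_2)\Big(\frac{\tau_2+h_k^{(2)}}{\theta_{2k}},\ \frac{-h_k^{*(2)}+(\tau_2+h_k^{(2)})x_2}{\theta_{2k}}\Big)$$ in the survival row. With $D_p=\operatorname{diag}(p(a))$ and componentwise powers, put $$J_\beta=W^TD_p^{\beta-1}W,\qquad K_\beta=W^T\big(D_p^{2\beta-1}-p^\beta(p^\beta)^T\big)W,\qquad \Sigma_\beta=J_\beta^{-1}K_\beta J_\beta^{-1}.$$ **Characteristics.** Let $x_0\in\mathbb R$ be the normal stress, $t_0\ge0$ a mission time and $\alpha_0\in(0,1)$. Write $\lambda_j(a)=\exp(-a_{0j}-a_{1j}x_0)$,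 $\Lambda(a)=\sum_j\lambda_j(a)$ and $\pi_{0j}=\lambda_j/\Lambda$. Under the constant stress $x_0$ the lifetime is the minimum of $R$ independent exponential variables with rates $\lambda_j(a)$. **Claim.** For every $a\in\mathbb R^{2R}$ the mean, the reliability at $t_0$ and the lower $\alpha_0$ quantile of the lifetime under stress $x_0$ are $$E(a)=\Lambda(a)^{-1},\qquad R_0(a)=e^{-t_0\Lambda(a)},\qquad Q_{1-\alpha_0}(a)=\frac{-\log(1-\alpha_0)}{\Lambda(a)},$$ and those of the exponential lifetime of risk $j$ alone are $$E_j(a)=e^{a_{0j}+a_{1j}x_0},\qquad R_j(a)=e^{-t_0\lambda_j(a)},\qquad Q_{j,1-\alpha_0}(a)=-\log(1-\alpha_0)\,e^{a_{0j}+a_{1j}x_0}.$$ The matrix $J_\beta(a_0)$ is invertible, and for each of these functions $g$, as $N\to\infty$, $$\sqrt N\big(g(\hat a^\beta)-g(a_0)\big)\xrightarrow{\ L\ }\mathcal N\big(0,\ \nabla g(a_0)^T\,\Sigma_\beta(a_0)\,\nabla g(a_0)\big),$$ where $\mathcal N(0,0)$ denotes the Dirac mass at $0$. The gradients consist of the two-dimensional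 blocks ($k=1,\dots,R$) $$\nabla E:\ \frac{\pi_{0k}}{\Lambda}(1,x_0),\qquad \nabla R_0:\ R_0\,t_0\,\lambda_k\,(1,x_0),\qquad \nabla Q_{1-\alpha_0}:\ \frac{-\log(1-\alpha_0)\,\pi_{0k}}{\Lambda}(1,x_0),$$ and the gradients of $E_j$, $R_j$, $Q_{j,1-\alpha_0}$ vanish outside the block of risk $j$, which is $E_j(1,x_0)$, $R_jt_0\lambda_j(1,x_0)$, $Q_{j,1-\alpha_0}(1,x_0)$ respectively. Hence, with $[\Sigma_\beta]_j$ the $2\times2$ diagonal block of $\Sigma_\beta(a_0)$ that belongs to risk $j$ and $B_j=(1,x_0)[\Sigma_\beta]_j(1,x_0)^T$, the cause-specific variances are $$\sigma^2(E_j)=E_j(a_0)^2B_j,\qquad \sigma^2(R_j)=R_j(a_0)^2\,t_0^2\,e^{-2a_{0j}-2a_{1j}x_0}B_j,\qquad \sigma^2(Q_{j,1-\alpha_0})=Q_{j,1-\alpha_0}(a_0)^2B_j,$$ where $a_{0j},a_{1j}$ in the exponent are the components of the true parameter. -/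

import Mathlib

open MeasureTheory ProbabilityTheory Filter
open scoped NNReal Matrix

noncomputable section

namespace StepStress

/-- Regression parameter `a = (a_{0j}, a_{1j})_j` for `R` risks: `a (j, 0)` is the intercept `a_{0j}`
and `a (j, 1)` is the slope `a_{1j}` of the log-linear stress relation. -/
abbrev Param (R : ℕ) := EuclideanSpace ℝ (Fin R × Fin 2)

/-- Cells of the multinomial model: `some (l, j)` is failure in the `l`-th inspection interval from
cause `j`, and `none` is survival beyond the end of the test. -/
abbrev Cell (L R : ℕ) := Option (Fin L × Fin R)

/-- A simple step-stress plan with two stress levels and inspection times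
`0 = IT_0 < IT_1 < ... < IT_L`; the time of stress change is one of the interior inspection times
and the test ends at the last one. -/
structure Plan (L : ℕ) where
  stress : Fin 2 → ℝ
  stress_ne : stress 0 ≠ stress 1
  inspect : Fin (L + 1) → ℝ
  inspect_zero : inspect 0 = 0
  inspect_strictMono : StrictMono inspect
  changeIdx : Fin (L + 1)
  changeIdx_pos : 0 < changeIdx
  changeIdx_lt : changeIdx < Fin.last L

variable {L R : ℕ}

/-- Time of stress change `τ₁`. -/
def Plan.tau1 (D : Plan L) : ℝ := D.inspect D.changeIdx

/-- Termination time `τ₂`. -/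
def Plan.tau2 (D : Plan L) : ℝ := D.inspect (Fin.last L)

/-- Stress level (`0` for the first, `1` for the second) in force throughout the inspection interval
`(IT_{l}, IT_{l+1}]`. -/
def Plan.stage (D : Plan L) (l : Fin L) : Fin 2 :=
  if D.inspect l.succ ≤ D.tau1 then 0 else 1

/-- Exponential scale `θ = exp (a_{0j} + a_{1j} x)` of risk `j` under constant stress `x`. -/
def scale (a : Param R) (x : ℝ) (j : Fin R) : ℝ := Real.exp (a (j, 0) + a (j, 1) * x)

/-- Failure rate `1 / θ = exp (- a_{0j} - a_{1j} x)` of risk `j` under constant stress `x`. -/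
def rate (a : Param R) (x : ℝ) (j : Fin R) : ℝ := Real.exp (-a (j, 0) - a (j, 1) * x)

/-- Relative risk of cause `j` under constant stress `x`. -/
def relRisk (a : Param R) (x : ℝ) (j : Fin R) : ℝ := rate a x j / ∑ j', rate a x j'

/-- Shifting time `h_j^{(i)}` of the cumulative exposure model. -/
def shift (D : Plan L) (a : Param R) (i : Fin 2) (j : Fin R) : ℝ :=
  ![0, D.tau1 * (scale a (D.stress 1) j / scale a (D.stress 0) j - 1)] i

/-- The quantity `h_j^{*(i)}`. -/
def shiftStar (D : Plan L) (a : Param R) (i : Fin 2) (j : Fin R) : ℝ :=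
  ![0, D.tau1 * (scale a (D.stress 1) j / scale a (D.stress 0) j)
        * (D.stress 1 - D.stress 0)] i

/-- CDF of the latent lifetime of risk `j` in the step-stress test (cumulative exposure model). -/
def causeCDF (D : Plan L) (a : Param R) (j : Fin R) (t : ℝ) : ℝ :=
  if t ≤ 0 then 0
  else if t < D.tau1 then 1 - Real.exp (-((t + shift D a 0 j) / scale a (D.stress 0) j))
  else 1 - Real.exp (-((t + shift D a 1 j) / scale a (D.stress 1) j))

/-- The function `exp (-∑_j (t + h_j^{(i)}) / θ_{ij})`. -/
def surv (D : Plan L) (a : Param R) (i : Fin 2) (t : ℝ) : ℝ :=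
  Real.exp (-∑ j, (t + shift D a i j) / scale a (D.stress i) j)

/-- Theoretical cell probabilities `p_{lj}(a)` and `p_0(a)`. -/
def cellProb (D : Plan L) (a : Param R) : Cell L R → ℝ
  | some (l, j) => relRisk a (D.stress (D.stage l)) j *
      (surv D a (D.stage l) (D.inspect l.castSucc) - surv D a (D.stage l) (D.inspect l.succ))
  | none => surv D a 1 D.tau2

/-- `D.FallsIn t c`: a unit with latent lifetimes `t_1, ..., t_R` is recorded in the cell `c`. The
unit fails at the smallest latent lifetime, from the cause that attains it. -/
def Plan.FallsIn (D : Plan L) (t : Fin R → ℝ) : Cell L R → Prop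
  | some (l, j) => D.inspect l.castSucc < t j ∧ t j ≤ D.inspect l.succ ∧ ∀ j', t j ≤ t j'
  | none => ∀ j, D.tau2 < t j

open Classical in
/-- Empirical probability vector of the first `N` units, where `T k j` is the latent lifetime of
the `k`-th unit for risk `j`. -/
def empirical {Ω : Type*} (D : Plan L) (T : ℕ → Fin R → Ω → ℝ) (N : ℕ) (ω : Ω) (c : Cell L R) : ℝ :=
  (((Finset.range N).filter (fun k => D.FallsIn (fun j => T k j ω) c)).card : ℝ) / N

/-- At least one failure is recorded for each combination of stress level and cause. -/
def AllObserved (D : Plan L) (q : Cell L R → ℝ) : Prop :=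
  ∀ (i : Fin 2) (j : Fin R), ∃ l, D.stage l = i ∧ 0 < q (some (l, j))

/-- Density power divergence with tuning parameter `β` between the probability vectors `q` and `p`;
at `β = 0` it is the Kullback–Leibler divergence. -/
def dpd (β : ℝ) (q p : Cell L R → ℝ) : ℝ :=
  if β = 0 then ∑ c, q c * Real.log (q c / p c)
  else ∑ c, (p c ^ (1 + β) - (1 + 1 / β) * (q c * p c ^ β) + 1 / β * q c ^ (β + 1))

/-- `a` is a minimum density power divergence estimate for the empirical vector `q`. -/
def IsMDPDE (D : Plan L) (β : ℝ) (q : Cell L R → ℝ) (a : Param R) : Prop :=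
  ∀ b : Param R, dpd β q (cellProb D a) ≤ dpd β q (cellProb D b)

/-- The quantities `(z_{lj})_{1k}` and `(z_{lj})_{2k}`, at the time `t` and the stress level `i`. -/
def zEntry (D : Plan L) (a : Param R) (i : Fin 2) (t : ℝ) (j : Fin R) (k : Fin R × Fin 2) : ℝ :=
  let x := D.stress i
  relRisk a x j * surv D a i t *
    ![(if j = k.1 then relRisk a x j - 1 else relRisk a x k.1)
        + (t + shift D a i k.1) / scale a x k.1,
      (if j = k.1 then relRisk a x j * x - x else relRisk a x k.1 * x)
        + (-shiftStar D a i k.1 + (t + shift D a i k.1) * x) / scale a x k.1] k.2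

/-- The matrix `W` at the parameter `a`. -/
def matW (D : Plan L) (a : Param R) : Matrix (Cell L R) (Fin R × Fin 2) ℝ :=
  Matrix.of fun c k => match c with
    | some (l, j) => zEntry D a (D.stage l) (D.inspect l.castSucc) j k
        - zEntry D a (D.stage l) (D.inspect l.succ) j k
    | none => surv D a 1 D.tau2 *
        ![(D.tau2 + shift D a 1 k.1) / scale a (D.stress 1) k.1,
          (-shiftStar D a 1 k.1 + (D.tau2 + shift D a 1 k.1) * D.stress 1)
            / scale a (D.stress 1) k.1] k.2

/-- The matrix `J_β(a) = Wᵀ D_p^{β-1} W`. -/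
def matJ (D : Plan L) (β : ℝ) (a : Param R) : Matrix (Fin R × Fin 2) (Fin R × Fin 2) ℝ :=
  (matW D a)ᵀ * Matrix.diagonal (fun c => cellProb D a c ^ (β - 1)) * matW D a

/-- The matrix `K_β(a) = Wᵀ (D_p^{2β-1} - p^β (p^β)ᵀ) W`. -/
def matK (D : Plan L) (β : ℝ) (a : Param R) : Matrix (Fin R × Fin 2) (Fin R × Fin 2) ℝ :=
  (matW D a)ᵀ *
    (Matrix.diagonal (fun c => cellProb D a c ^ (2 * β - 1))
      - Matrix.vecMulVec (fun c => cellProb D a c ^ β) (fun c => cellProb D a c ^ β)) * matW D a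

/-- The asymptotic covariance matrix `Σ_β(a) = J_β(a)⁻¹ K_β(a) J_β(a)⁻¹`. -/
def matSigma (D : Plan L) (β : ℝ) (a : Param R) : Matrix (Fin R × Fin 2) (Fin R × Fin 2) ℝ :=
  (matJ D β a)⁻¹ * matK D β a * (matJ D β a)⁻¹

/-- The `2 × 2` diagonal block of a matrix that belongs to the parameters of risk `j`. -/
def block (S : Matrix (Fin R × Fin 2) (Fin R × Fin 2) ℝ) (j : Fin R) : Matrix (Fin 2) (Fin 2) ℝ :=
  S.submatrix (fun i => (j, i)) (fun i => (j, i))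

/-- The quadratic form `(1, x₀) B (1, x₀)ᵀ`. -/
def blockForm (B : Matrix (Fin 2) (Fin 2) ℝ) (x0 : ℝ) : ℝ := ![1, x0] ⬝ᵥ (B *ᵥ ![1, x0])

/-- Mean lifetime under constant stress `x0`. -/
def meanLife (x0 : ℝ) (a : Param R) : ℝ := (∑ j, rate a x0 j)⁻¹

/-- Reliability at the mission time `t0` under constant stress `x0`. -/
def reliability (x0 t0 : ℝ) (a : Param R) : ℝ := Real.exp (-t0 * ∑ j, rate a x0 j)

/-- Lower `α0` quantile of the lifetime under constant stress `x0`. -/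
def quantile (x0 α0 : ℝ) (a : Param R) : ℝ := -Real.log (1 - α0) / ∑ j, rate a x0 j

/-- Gradient of `meanLife`, in blocks `π_{0k} (∑_j rate_j)⁻¹ (1, x0)`. -/
def gradMean (x0 : ℝ) (a : Param R) : Param R :=
  WithLp.toLp 2 fun k => relRisk a x0 k.1 / (∑ j, rate a x0 j) * ![1, x0] k.2

/-- Gradient of `reliability`, in blocks `R₀(a) t0 rate_k (1, x0)`. -/
def gradReliability (x0 t0 : ℝ) (a : Param R) : Param R :=
  WithLp.toLp 2 fun k => reliability x0 t0 a * t0 * rate a x0 k.1 * ![1, x0] k.2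

/-- Gradient of `quantile`, in blocks `-log (1 - α0) π_{0k} (∑_j rate_j)⁻¹ (1, x0)`. -/
def gradQuantile (x0 α0 : ℝ) (a : Param R) : Param R :=
  WithLp.toLp 2 fun k =>
    -Real.log (1 - α0) * relRisk a x0 k.1 / (∑ j, rate a x0 j) * ![1, x0] k.2

/-- Mean lifetime of risk `j` alone under constant stress `x0`. -/
def causeMean (x0 : ℝ) (j : Fin R) (a : Param R) : ℝ := Real.exp (a (j, 0) + a (j, 1) * x0)

/-- Reliability of risk `j` alone at the mission time `t0` under constant stress `x0`. -/
def causeReliability (x0 t0 : ℝ) (j : Fin R) (a : Param R) : ℝ :=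
  Real.exp (-t0 * Real.exp (-a (j, 0) - a (j, 1) * x0))

/-- Lower `α0` quantile of the lifetime of risk `j` alone under constant stress `x0`. -/
def causeQuantile (x0 α0 : ℝ) (j : Fin R) (a : Param R) : ℝ :=
  -Real.log (1 - α0) * Real.exp (a (j, 0) + a (j, 1) * x0)

/-- The vector with the block `c • (1, x0)` at the parameters of risk `j` and `0` elsewhere. -/
def blockVec (x0 : ℝ) (j : Fin R) (c : ℝ) : Param R :=
  WithLp.toLp 2 fun k => if k.1 = j then c * ![1, x0] k.2 else 0

/-- Law of the lifetime `min_j T_j` under constant stress `x0`, for independent exponential `T_j`. -/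
def lifetimeLaw (x0 : ℝ) (a : Param R) : Measure ℝ :=
  (Measure.pi fun j => expMeasure (rate a x0 j)).map fun t => ⨅ j, t j

/-- `m`, `r`, `q` are the mean, the reliability at `t0` and the lower `α0` quantile of the
probability distribution `P`. -/
def HasCharacteristics (P : Measure ℝ) (t0 α0 m r q : ℝ) : Prop :=
  IsProbabilityMeasure P ∧ Integrable (fun t : ℝ => t) P ∧ ∫ t, t ∂P = m ∧
    P.real (Set.Ioi t0) = r ∧ IsLeast {t | α0 ≤ P.real (Set.Iic t)} q

/-- `√N (X_N - c)` converges in distribution to the centred normal law with variance `s` (which may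
be the Dirac mass at `0`, for `s = 0`). -/
def AsympNormal {Ω : Type*} [MeasurableSpace Ω] (μ : Measure Ω) [IsProbabilityMeasure μ]
    (X : ℕ → Ω → ℝ) (c s : ℝ) : Prop :=
  ∃ v : ℝ≥0, (v : ℝ) = s ∧
    TendstoInDistribution (fun (N : ℕ) ω => √(N : ℝ) * (X N ω - c)) atTop
      (id : ℝ → ℝ) (fun _ => μ) (gaussianReal 0 v)

/-- The delta-method statement for a characteristic `g` with gradient `G` at `a`: `G` is the
gradient, and the plug-in estimator is asymptotically normal with variance `Gᵀ S G`. -/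
def DeltaNormal {Ω : Type*} [MeasurableSpace Ω] (μ : Measure Ω) [IsProbabilityMeasure μ]
    (est : ℕ → Ω → Param R) (S : Matrix (Fin R × Fin 2) (Fin R × Fin 2) ℝ)
    (g : Param R → ℝ) (G a : Param R) : Prop :=
  HasGradientAt g G a ∧
    AsympNormal μ (fun N ω => g (est N ω)) (g a) ((⇑G) ⬝ᵥ (S *ᵥ (⇑G)))

end StepStress

end

/-! The estimator enters only through the empirical cell frequencies q, so the theorem splits into a
deterministic expansion of minimisers around p(a₀) and a limit theorem for q.

Identifiability: each coordinate of the parameter is a function of the cell probabilities,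
differentiable at p(a₀) (`exists_leftInverse_coord`). The total cause-specific masses of the two
stages and the survival cell give the rates, whose logarithms are affine in the stress. By the chain
rule W, which is the Jacobian of p (`hasPartials_cellProb`), is injective, so J_β = Wᵀ D W with D
positive diagonal is invertible. By continuity of the inverse, parameters with p(a) near p(a₀) are
near a₀.

Localisation: a small divergence forces two probability vectors to be uniformly close
(`dpd_separation`). For q near p(a₀) every parameter that does no worse than a₀ thus lies in a small
ball, so a minimiser exists and all minimisers are near a₀ (`exists_isMDPDE_near`).

Linearisation: at a minimiser the gradient vanishes, that is, Σ_c W_ck p_c^{β-1} (p_c - q_c) = 0 for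
each k. Replacing p(a) - p(a₀) by W (a - a₀) gives a - a₀ = J⁻¹ Wᵀ D_p^{β-1} (q - p(a₀)) + o(‖q -
p(a₀)‖). This is proved for arbitrary pairs (q, minimiser) tending to (p(a₀), a₀), so neither
uniqueness of the minimiser nor the implicit function theorem is needed. Composing with g yields the
influence vector and `mdpde_expansion`.

Probability: integrating the competing-risk density shows that a unit falls in cell c with
probability p_c(a₀) (`measureReal_fallsIn`). A linear functional of q is a mean of i.i.d. bounded
scores, and the scalar central limit theorem applies. Chebyshev's inequality makes √N times the
remainder vanish in probability, and Slutsky's lemma gives normality. The variance of one score of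
the influence vector is the multinomial variance, which equals ∇gᵀ Σ_β ∇g (`variance_influence`). -/

noncomputable section

namespace StepStress

open scoped Topology ENNReal
open Asymptotics

/-! ### Calculus of partial derivatives; hazards and cell probabilities of the model. -/

section Model

variable {L R : ℕ}

/-! ### Calculus of gradients given by their components -/

section Gradient

variable {ι : Type*} [Fintype ι]

/-- The function `f` is differentiable at `a`, with partial derivatives `G`. -/
def HasPartials (f : EuclideanSpace ℝ ι → ℝ) (G : ι → ℝ) (a : EuclideanSpace ℝ ι) : Prop :=
  HasGradientAt f (WithLp.toLp 2 G) a

/-- Bridge to the Fréchet derivative. The coordinate form allows direct comparison with the entries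
of W, while the calculus rules come from `HasFDerivAt`. -/
lemma hasPartials_iff {f : EuclideanSpace ℝ ι → ℝ} {G : ι → ℝ} {a : EuclideanSpace ℝ ι} :
    HasPartials f G a ↔
      HasFDerivAt f (∑ k, G k • (EuclideanSpace.proj k : EuclideanSpace ℝ ι →L[ℝ] ℝ)) a := by
  unfold HasPartials
  rw [hasGradientAt_iff_hasFDerivAt]
  refine iff_of_eq (congrArg (HasFDerivAt f · a) ?_)
  ext v
  simp [PiLp.inner_apply, mul_comm]

lemma HasPartials.congr_partials {f : EuclideanSpace ℝ ι → ℝ} {G G' : ι → ℝ}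
    {a : EuclideanSpace ℝ ι} (h : HasPartials f G a) (e : ∀ k, G k = G' k) :
    HasPartials f G' a := by
  rwa [← funext e]

lemma hasPartials_const (c : ℝ) (a : EuclideanSpace ℝ ι) :
    HasPartials (fun _ => c) (fun _ => 0) a := by
  rw [hasPartials_iff]
  simpa using hasFDerivAt_const c a

lemma hasPartials_coord [DecidableEq ι] (i : ι) (a : EuclideanSpace ℝ ι) :
    HasPartials (fun a => a i) (fun k => if k = i then 1 else 0) a := by
  rw [hasPartials_iff]
  simpa using (EuclideanSpace.proj i : EuclideanSpace ℝ ι →L[ℝ] ℝ).hasFDerivAt (x := a)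

variable {f g : EuclideanSpace ℝ ι → ℝ} {F G : ι → ℝ} {a : EuclideanSpace ℝ ι}

lemma HasPartials.add (hf : HasPartials f F a) (hg : HasPartials g G a) :
    HasPartials (fun a => f a + g a) (fun k => F k + G k) a := by
  rw [hasPartials_iff] at *
  simpa [add_smul, Finset.sum_add_distrib] using! hf.add hg

lemma HasPartials.mul (hf : HasPartials f F a) (hg : HasPartials g G a) :
    HasPartials (fun a => f a * g a) (fun k => f a * G k + g a * F k) a := by
  rw [hasPartials_iff] at *
  simpa [add_smul, Finset.sum_add_distrib, Finset.smul_sum, mul_smul] using! hf.mul hg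

lemma HasPartials.comp {φ : ℝ → ℝ} {φ' : ℝ} (hφ : HasDerivAt φ φ' (f a))
    (hf : HasPartials f F a) : HasPartials (fun a => φ (f a)) (fun k => φ' * F k) a := by
  rw [hasPartials_iff] at *
  simpa [Finset.smul_sum, mul_smul] using! hφ.comp_hasFDerivAt a hf

lemma HasPartials.const_mul (c : ℝ) (hf : HasPartials f F a) :
    HasPartials (fun a => c * f a) (fun k => c * F k) a :=
  ((hasPartials_const c a).mul hf).congr_partials fun k => by ring

lemma HasPartials.neg (hf : HasPartials f F a) :
    HasPartials (fun a => -f a) (fun k => -F k) a := by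
  simpa using hf.const_mul (-1)

lemma HasPartials.sub (hf : HasPartials f F a) (hg : HasPartials g G a) :
    HasPartials (fun a => f a - g a) (fun k => F k - G k) a := by
  simpa [sub_eq_add_neg] using hf.add hg.neg

lemma HasPartials.exp (hf : HasPartials f F a) :
    HasPartials (fun a => Real.exp (f a)) (fun k => Real.exp (f a) * F k) a :=
  HasPartials.comp (Real.hasDerivAt_exp (f a)) hf

lemma HasPartials.sum {κ : Type*} (s : Finset κ) {f : κ → EuclideanSpace ℝ ι → ℝ}
    {F : κ → ι → ℝ} (h : ∀ j ∈ s, HasPartials (f j) (F j) a) :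
    HasPartials (fun a => ∑ j ∈ s, f j a) (fun k => ∑ j ∈ s, F j k) a := by
  classical
  induction s using Finset.induction_on with
  | empty => simpa using hasPartials_const 0 a
  | insert j s hj ih =>
    simp only [Finset.sum_insert hj]
    exact (h j (by simp)).add (ih fun i hi => h i (by simp [hi]))

lemma HasPartials.inv (hf : HasPartials f F a) (h : f a ≠ 0) :
    HasPartials (fun a => (f a)⁻¹) (fun k => -F k / f a ^ 2) a :=
  (HasPartials.comp (hasDerivAt_inv h) hf).congr_partials fun k => by ring

lemma HasPartials.unique (hf : HasPartials f F a) (hf' : HasPartials f G a) (k : ι) :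
    F k = G k := by
  have := HasGradientAt.unique hf hf'
  exact congrFun (congrArg WithLp.ofLp this) k

lemma HasPartials.continuousAt (hf : HasPartials f F a) : ContinuousAt f a :=
  (hasPartials_iff.1 hf).continuousAt

lemma HasPartials.eq_zero_of_isLocalMin (hf : HasPartials f F a) (h : IsLocalMin f a) (k : ι) :
    F k = 0 := by
  classical
  have := congrArg (fun l => l (EuclideanSpace.single k (1 : ℝ)))
    (h.hasFDerivAt_eq_zero (hasPartials_iff.1 hf))
  simpa [Pi.single_apply] using this

end Gradient

/-! ### Rates, relative risks and survival functions -/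

lemma rate_pos (a : Param R) (x : ℝ) (j : Fin R) : 0 < rate a x j := Real.exp_pos _

lemma scale_eq_inv_rate (a : Param R) (x : ℝ) (j : Fin R) : scale a x j = (rate a x j)⁻¹ := by
  rw [scale, rate, ← Real.exp_neg]
  ring_nf

lemma sum_rate_pos (hR : 1 ≤ R) (a : Param R) (x : ℝ) : 0 < ∑ j, rate a x j := by
  have : Nonempty (Fin R) := ⟨⟨0, hR⟩⟩
  exact Finset.sum_pos (fun j _ => rate_pos a x j) Finset.univ_nonempty

lemma relRisk_pos (hR : 1 ≤ R) (a : Param R) (x : ℝ) (j : Fin R) : 0 < relRisk a x j :=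
  div_pos (rate_pos a x j) (sum_rate_pos hR a x)

lemma sum_relRisk (hR : 1 ≤ R) (a : Param R) (x : ℝ) : ∑ j, relRisk a x j = 1 := by
  simp only [relRisk, ← Finset.sum_div]
  exact div_self (sum_rate_pos hR a x).ne'

/-- Cumulative hazard of risk `j` at time `t`, by the formula valid under the `i`-th stress level. -/
def cumHazard (D : Plan L) (a : Param R) (i : Fin 2) (t : ℝ) (j : Fin R) : ℝ :=
  ![t * rate a (D.stress 0) j,
    D.tau1 * rate a (D.stress 0) j + (t - D.tau1) * rate a (D.stress 1) j] i

/-- The shift exists to make the cumulative hazard continuous at the stress change. In hazard form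
it disappears: exposure accrues at the first rate up to the change and at the second rate
afterwards. -/
lemma add_shift_div_scale (D : Plan L) (a : Param R) (i : Fin 2) (t : ℝ) (j : Fin R) :
    (t + shift D a i j) / scale a (D.stress i) j = cumHazard D a i t j := by
  have h0 := (rate_pos a (D.stress 0) j).ne'
  have h1 := (rate_pos a (D.stress 1) j).ne'
  fin_cases i
  · simp [shift, cumHazard, scale_eq_inv_rate]
  · simp only [shift, cumHazard, scale_eq_inv_rate]
    simp
    field_simp
    ring

lemma surv_eq (D : Plan L) (a : Param R) (i : Fin 2) (t : ℝ) :
    surv D a i t = Real.exp (-∑ j, cumHazard D a i t j) := by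
  simp only [surv, add_shift_div_scale]

lemma surv_zero_eq (D : Plan L) (a : Param R) (t : ℝ) :
    surv D a 0 t = Real.exp (-(t * ∑ j, rate a (D.stress 0) j)) := by
  simp [surv_eq, cumHazard, Finset.mul_sum]

lemma surv_one_eq (D : Plan L) (a : Param R) (t : ℝ) :
    surv D a 1 t = Real.exp (-(D.tau1 * ∑ j, rate a (D.stress 0) j
      + (t - D.tau1) * ∑ j, rate a (D.stress 1) j)) := by
  simp [surv_eq, cumHazard, Finset.mul_sum, Finset.sum_add_distrib]

lemma surv_pos (D : Plan L) (a : Param R) (i : Fin 2) (t : ℝ) : 0 < surv D a i t :=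
  Real.exp_pos _

lemma cumHazard_tau1 (D : Plan L) (a : Param R) (i i' : Fin 2) (j : Fin R) :
    cumHazard D a i D.tau1 j = cumHazard D a i' D.tau1 j := by
  fin_cases i <;> fin_cases i' <;> simp [cumHazard]

lemma surv_tau1 (D : Plan L) (a : Param R) (i i' : Fin 2) :
    surv D a i D.tau1 = surv D a i' D.tau1 := by
  simp only [surv_eq, cumHazard_tau1 D a i i']

lemma surv_strictAnti (hR : 1 ≤ R) (D : Plan L) (a : Param R) (i : Fin 2) :
    StrictAnti (surv D a i) := by
  intro s t hst
  have h0 := sum_rate_pos hR a (D.stress 0)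
  have h1 := sum_rate_pos hR a (D.stress 1)
  fin_cases i
  · simp only [Fin.zero_eta, surv_zero_eq]
    gcongr
  · simp only [Fin.mk_one, surv_one_eq]
    gcongr

lemma Plan.tau1_pos (D : Plan L) : 0 < D.tau1 := by
  rw [← D.inspect_zero]
  exact D.inspect_strictMono D.changeIdx_pos

lemma Plan.tau1_lt_tau2 (D : Plan L) : D.tau1 < D.tau2 := D.inspect_strictMono D.changeIdx_lt

lemma Plan.stage_eq_zero_iff (D : Plan L) (l : Fin L) : D.stage l = 0 ↔ l.succ ≤ D.changeIdx := by
  have h := D.inspect_strictMono.le_iff_le (a := l.succ) (b := D.changeIdx)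
  unfold Plan.stage Plan.tau1
  split_ifs with h' <;> simp [← h, h']

lemma Plan.stage_eq_one_iff (D : Plan L) (l : Fin L) :
    D.stage l = 1 ↔ D.changeIdx ≤ l.castSucc := by
  have h := D.stage_eq_zero_iff l
  have : D.stage l = 1 ↔ ¬ D.stage l = 0 := by omega
  rw [this, h, not_le, Fin.le_castSucc_iff]

lemma cellProb_pos (hR : 1 ≤ R) (D : Plan L) (a : Param R) (c : Cell L R) :
    0 < cellProb D a c := by
  rcases c with _ | ⟨l, j⟩
  · exact surv_pos D a 1 _
  · exact mul_pos (relRisk_pos hR a _ j)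
      (sub_pos.2 (surv_strictAnti hR D a _ (D.inspect_strictMono l.castSucc_lt_succ)))

/-- Total probability of the cells of stage `i` and cause `j`. -/
lemma sum_stage_cellProb (D : Plan L) (a : Param R) (j : Fin R) (i : Fin 2) :
    ∑ l, (if D.stage l = i then cellProb D a (some (l, j)) else 0) =
      relRisk a (D.stress i) j *
        (surv D a i (![0, D.tau1] i) - surv D a i (![D.tau1, D.tau2] i)) := by
  -- telescoping along the clamped inspection times
  set lo := ![0, D.tau1] i with hlo
  set hi := ![D.tau1, D.tau2] i with hhi
  let f : ℕ → ℝ := fun n => if h : n < L + 1 then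
    surv D a i (max lo (min hi (D.inspect ⟨n, h⟩))) else 0
  -- An interval of the other stage lies entirely on one side of `[lo, hi]`, so its two clamped
  -- endpoints coincide and the difference vanishes, as the `if` requires. On an interval of stage
  -- `i` the clamping does nothing.
  have key : ∀ l : Fin L, (if D.stage l = i then cellProb D a (some (l, j)) else 0) =
      relRisk a (D.stress i) j * (f l - f (l + 1)) := by
    intro l
    have hf1 : f l = surv D a i (max lo (min hi (D.inspect l.castSucc))) := by
      have : (l : ℕ) < L + 1 := by omega
      simp only [f, this, dif_pos]; rfl
    have hf2 : f (l + 1) = surv D a i (max lo (min hi (D.inspect l.succ))) := by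
      have : (l : ℕ) + 1 < L + 1 := by omega
      simp only [f, this, dif_pos]; rfl
    have hm := D.inspect_strictMono.monotone
    have h0 : ∀ m, 0 ≤ D.inspect m := fun m => by
      rw [← D.inspect_zero]; exact hm (Fin.zero_le m)
    have hL : ∀ m, D.inspect m ≤ D.tau2 := fun m => hm (Fin.le_last m)
    rw [hf1, hf2]
    have hs0 := D.stage_eq_zero_iff l
    have hs1 := D.stage_eq_one_iff l
    have hcs := hm l.castSucc_lt_succ.le
    have ht := D.tau1_lt_tau2
    rcases (by omega : D.stage l = 0 ∨ D.stage l = 1) with h | h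
    · have h2 : D.inspect l.succ ≤ D.tau1 := hm (hs0.1 h)
      fin_cases i
      · simp only [Fin.zero_eta] at *
        simp [hlo, hhi, cellProb, h, h0, h2, hcs.trans h2]
      · simp only [Fin.mk_one, h] at *
        simp [hlo, hhi, h2, hcs.trans h2, (h2.trans ht.le), ((hcs.trans h2).trans ht.le)]
    · have h2 : D.tau1 ≤ D.inspect l.castSucc := hm (hs1.1 h)
      fin_cases i
      · simp only [Fin.zero_eta, h] at *
        simp [hlo, hhi, h2, h2.trans hcs]
      · simp only [Fin.mk_one] at *
        simp [hlo, hhi, cellProb, h, h2, h2.trans hcs, hL]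
  rw [Finset.sum_congr rfl fun l _ => key l, ← Finset.mul_sum,
    Fin.sum_univ_eq_sum_range (fun n => f n - f (n + 1)), Finset.sum_range_sub']
  have ht := D.tau1_lt_tau2
  have h0 := D.tau1_pos
  have e0 : f 0 = surv D a i lo := by
    have : D.inspect ⟨0, by omega⟩ = 0 := D.inspect_zero
    simp only [f, Nat.zero_lt_succ, dif_pos, this]
    fin_cases i <;> simp [hlo, hhi, h0.le, (h0.trans ht).le]
  have e1 : f L = surv D a i hi := by
    have : D.inspect ⟨L, by omega⟩ = D.tau2 := rfl
    simp only [f, Nat.lt_succ_self, dif_pos, this]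
    fin_cases i <;> simp [hlo, hhi, h0.le, ht.le]
  rw [e0, e1]

/-- Summed over causes the relative risks give one, and the two stage masses telescope against the
survival cell. Being purely algebraic, this can later serve to prove that almost no unit escapes all
cells. -/
lemma sum_cellProb (hR : 1 ≤ R) (D : Plan L) (a : Param R) : ∑ c, cellProb D a c = 1 := by
  have split : ∀ l j, cellProb D a (some (l, j)) =
      ∑ i : Fin 2, if D.stage l = i then cellProb D a (some (l, j)) else 0 := by
    intro l j; simp
  rw [Fintype.sum_option, Fintype.sum_prod_type, Finset.sum_comm]
  have : ∀ j, ∑ l, cellProb D a (some (l, j)) =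
      relRisk a (D.stress 0) j * (1 - surv D a 1 D.tau1) +
      relRisk a (D.stress 1) j * (surv D a 1 D.tau1 - surv D a 1 D.tau2) := by
    intro j
    rw [Finset.sum_congr rfl fun l _ => split l j, Finset.sum_comm, Fin.sum_univ_two,
      sum_stage_cellProb, sum_stage_cellProb]
    have : surv D a 0 0 = 1 := by simp [surv_zero_eq]
    simp [this, surv_tau1 D a 0 1]
  rw [Finset.sum_congr rfl fun j _ => this j, Finset.sum_add_distrib, ← Finset.sum_mul,
    ← Finset.sum_mul, sum_relRisk hR, sum_relRisk hR]
  simp only [cellProb]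
  ring

end Model

/-! ### Derivatives of the cell probabilities, identifiability, invertibility of J. -/

section Jacobian

variable {L R : ℕ}

/-! ### The matrix `W` is the Jacobian of the cell probabilities -/

lemma hasPartials_rate (a : Param R) (x : ℝ) (j : Fin R) :
    HasPartials (fun a => rate a x j)
      (fun k => if k.1 = j then -rate a x j * ![1, x] k.2 else 0) a := by
  refine (HasPartials.exp (((hasPartials_coord (j, 0) a).neg).sub
    ((hasPartials_coord (j, 1) a).mul (hasPartials_const x a)))).congr_partials ?_
  rintro ⟨k, i⟩
  by_cases hk : k = j <;> fin_cases i <;> simp [hk, rate]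

lemma hasPartials_sum_rate (a : Param R) (x : ℝ) :
    HasPartials (fun a => ∑ j, rate a x j) (fun k => -rate a x k.1 * ![1, x] k.2) a :=
  (HasPartials.sum Finset.univ fun j _ => hasPartials_rate a x j).congr_partials fun k => by simp

lemma hasPartials_relRisk (hR : 1 ≤ R) (a : Param R) (x : ℝ) (j : Fin R) :
    HasPartials (fun a => relRisk a x j)
      (fun k => relRisk a x j * (relRisk a x k.1 - if j = k.1 then 1 else 0) * ![1, x] k.2) a := by
  have h0 := (sum_rate_pos hR a x).ne'
  simp only [relRisk, div_eq_mul_inv (rate _ x j)]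
  refine ((hasPartials_rate a x j).mul ((hasPartials_sum_rate a x).inv h0)).congr_partials ?_
  intro k
  by_cases hk : j = k.1
  · simp only [hk, if_true]
    field_simp
    ring
  · simp only [hk, Ne.symm hk, if_false]
    field_simp
    ring

/-- Minus the partial derivatives of the cumulative hazard of a risk with respect to its own
parameters. -/
def hazardPartial (D : Plan L) (a : Param R) (i : Fin 2) (t : ℝ) (k : Fin R × Fin 2) : ℝ :=
  ![t * rate a (D.stress 0) k.1 * ![1, D.stress 0] k.2,
    D.tau1 * rate a (D.stress 0) k.1 * ![1, D.stress 0] k.2 +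
      (t - D.tau1) * rate a (D.stress 1) k.1 * ![1, D.stress 1] k.2] i

/-- The starred shift corrects the weight of the first-stage exposure: multiplying everything by the
second stress would count that exposure with the wrong stress, and subtracting the starred shift
restores the first one. -/
lemma hazardPartial_eq (D : Plan L) (a : Param R) (i : Fin 2) (t : ℝ) (k : Fin R × Fin 2) :
    ![(t + shift D a i k.1) / scale a (D.stress i) k.1,
      (-shiftStar D a i k.1 + (t + shift D a i k.1) * D.stress i) / scale a (D.stress i) k.1] k.2 =
      hazardPartial D a i t k := by
  obtain ⟨k, m⟩ := k
  have h0 := (rate_pos a (D.stress 0) k).ne'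
  have h1 := (rate_pos a (D.stress 1) k).ne'
  fin_cases i <;> fin_cases m <;>
    simp [shift, shiftStar, hazardPartial, scale_eq_inv_rate] <;> field_simp <;> ring

lemma hasPartials_surv (D : Plan L) (a : Param R) (i : Fin 2) (t : ℝ) :
    HasPartials (fun a => surv D a i t) (fun k => surv D a i t * hazardPartial D a i t k) a := by
  fin_cases i
  · simp only [Fin.zero_eta, surv_zero_eq]
    refine ((hasPartials_sum_rate a (D.stress 0)).const_mul t).neg.exp.congr_partials fun k => ?_
    simp [hazardPartial]
    ring_nf
  · simp only [Fin.mk_one, surv_one_eq]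
    refine (((hasPartials_sum_rate a (D.stress 0)).const_mul D.tau1).add
      ((hasPartials_sum_rate a (D.stress 1)).const_mul (t - D.tau1))).neg.exp.congr_partials
      fun k => ?_
    simp only [hazardPartial, Matrix.cons_val_one, Matrix.cons_val_fin_one]
    ring

lemma zEntry_eq (D : Plan L) (a : Param R) (i : Fin 2) (t : ℝ) (j : Fin R) (k : Fin R × Fin 2) :
    zEntry D a i t j k = relRisk a (D.stress i) j * surv D a i t *
      ((relRisk a (D.stress i) k.1 - if j = k.1 then 1 else 0) * ![1, D.stress i] k.2 +
        hazardPartial D a i t k) := by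
  rw [← hazardPartial_eq]
  obtain ⟨k, m⟩ := k
  by_cases hk : j = k <;> fin_cases m <;> (simp [zEntry, hk]; try ring_nf; try tauto)

lemma hasPartials_relRisk_mul_surv (hR : 1 ≤ R) (D : Plan L) (a : Param R) (i : Fin 2) (t : ℝ)
    (j : Fin R) :
    HasPartials (fun a => relRisk a (D.stress i) j * surv D a i t) (zEntry D a i t j) a :=
  ((hasPartials_relRisk hR a (D.stress i) j).mul (hasPartials_surv D a i t)).congr_partials
    fun k => by rw [zEntry_eq]; ring

lemma hasPartials_cellProb (hR : 1 ≤ R) (D : Plan L) (a : Param R) (c : Cell L R) :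
    HasPartials (fun a => cellProb D a c) (matW D a c) a := by
  rcases c with _ | ⟨l, j⟩
  · refine (hasPartials_surv D a 1 D.tau2).congr_partials fun k => ?_
    rw [← hazardPartial_eq]
    rfl
  · simp only [cellProb, mul_sub]
    exact (hasPartials_relRisk_mul_surv hR D a _ _ j).sub (hasPartials_relRisk_mul_surv hR D a _ _ j)

lemma continuous_cellProb (hR : 1 ≤ R) (D : Plan L) (c : Cell L R) :
    Continuous fun a : Param R => cellProb D a c :=
  continuous_iff_continuousAt.2 fun a => (hasPartials_cellProb hR D a c).continuousAt

lemma continuous_rate (x : ℝ) (j : Fin R) : Continuous fun a => rate a x j :=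
  continuous_iff_continuousAt.2 fun a => (hasPartials_rate a x j).continuousAt

lemma continuous_relRisk (hR : 1 ≤ R) (x : ℝ) (j : Fin R) : Continuous fun a => relRisk a x j :=
  continuous_iff_continuousAt.2 fun a => (hasPartials_relRisk hR a x j).continuousAt

lemma continuous_surv (D : Plan L) (i : Fin 2) (t : ℝ) :
    Continuous fun a : Param R => surv D a i t :=
  continuous_iff_continuousAt.2 fun a => (hasPartials_surv D a i t).continuousAt

lemma continuous_hazardPartial (D : Plan L) (i : Fin 2) (t : ℝ) (k : Fin R × Fin 2) :
    Continuous fun a => hazardPartial D a i t k := by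
  have h0 := continuous_rate (D.stress 0) k.1
  have h1 := continuous_rate (D.stress 1) k.1
  fin_cases i <;> simp [hazardPartial] <;> fun_prop

lemma continuous_zEntry (hR : 1 ≤ R) (D : Plan L) (i : Fin 2) (t : ℝ) (j : Fin R)
    (k : Fin R × Fin 2) : Continuous fun a => zEntry D a i t j k := by
  have h0 := continuous_relRisk hR (D.stress i) j
  have h1 := continuous_relRisk hR (D.stress i) k.1
  have h2 := continuous_surv (R := R) D i t
  have h3 := continuous_hazardPartial D i t k
  simp only [zEntry_eq]
  fun_prop

lemma continuous_matW (hR : 1 ≤ R) (D : Plan L) (c : Cell L R) (k : Fin R × Fin 2) :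
    Continuous fun a => matW D a c k := by
  rcases c with _ | ⟨l, j⟩
  · have h2 := continuous_surv (R := R) D 1 D.tau2
    have h3 := continuous_hazardPartial D 1 D.tau2 k
    simp only [matW, Matrix.of_apply, hazardPartial_eq]
    fun_prop
  · exact (continuous_zEntry hR D _ _ j k).sub (continuous_zEntry hR D _ _ j k)

/-- Differentiate the identity that the total mass is one. -/
lemma sum_matW (hR : 1 ≤ R) (D : Plan L) (a : Param R) (k : Fin R × Fin 2) :
    ∑ c, matW D a c k = 0 := by
  have h := HasPartials.sum Finset.univ fun c _ => hasPartials_cellProb hR D a c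
  simp only [sum_cellProb hR] at h
  exact h.unique (hasPartials_const 1 a) k

/-! ### Identifiability -/

/-- The parameter is a differentiable function of the cell probabilities. -/
lemma exists_leftInverse_coord (hR : 1 ≤ R) (D : Plan L) (a₀ : Param R) (k : Fin R × Fin 2) :
    ∃ ψ : (Cell L R → ℝ) → ℝ, DifferentiableAt ℝ ψ (cellProb D a₀) ∧
      ∀ a, ψ (cellProb D a) = a k := by
  -- total probability of stage `i` and cause `j`
  let A : Fin 2 → Fin R → (Cell L R → ℝ) → ℝ := fun i j q =>
    ∑ l, if D.stage l = i then q (some (l, j)) else 0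
  -- `T` recovers the survival at the stress change. The drop of log survival over a stage, divided
  -- by its duration, is the total rate `lam`; the observed shares of the causes split it into
  -- single rates. Their logarithms `ℓ` are affine in the stress, and two distinct stresses
  -- determine slope and intercept. Away from the image of the model the values of `ψ` do not
  -- matter.
  let T : (Cell L R → ℝ) → ℝ := fun q => 1 - ∑ j, A 0 j q
  let lam : Fin 2 → (Cell L R → ℝ) → ℝ := fun i q =>
    ![-Real.log (T q) / D.tau1, (Real.log (T q) - Real.log (q none)) / (D.tau2 - D.tau1)] i
  let ℓ : Fin 2 → Fin R → (Cell L R → ℝ) → ℝ := fun i j q =>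
    Real.log (A i j q / (∑ j', A i j' q) * lam i q)
  let slope : Fin R → (Cell L R → ℝ) → ℝ := fun j q =>
    (ℓ 0 j q - ℓ 1 j q) / (D.stress 1 - D.stress 0)
  let ψ : (Cell L R → ℝ) → ℝ := fun q =>
    ![-ℓ 0 k.1 q - slope k.1 q * D.stress 0, slope k.1 q] k.2
  have hτ1 := D.tau1_pos
  have hτ2 := sub_pos.2 D.tau1_lt_tau2
  let m : Fin 2 → Param R → ℝ := fun i a =>
    surv D a i (![0, D.tau1] i) - surv D a i (![D.tau1, D.tau2] i)
  have hm : ∀ i a, 0 < m i a := by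
    intro i a
    refine sub_pos.2 (surv_strictAnti hR D a i ?_)
    fin_cases i
    · simpa using hτ1
    · simpa using hτ2
  have hA : ∀ i j a, A i j (cellProb D a) = relRisk a (D.stress i) j * m i a := fun i j a =>
    sum_stage_cellProb D a j i
  have hAs : ∀ i a, ∑ j, A i j (cellProb D a) = m i a := by
    intro i a
    simp only [hA, ← Finset.sum_mul, sum_relRisk hR, one_mul]
  have hT : ∀ a, T (cellProb D a) = surv D a 0 D.tau1 := by
    intro a
    simp [T, hAs, m, surv_zero_eq]
  have hlam : ∀ i a, lam i (cellProb D a) = ∑ j, rate a (D.stress i) j := by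
    intro i a
    fin_cases i
    · simp [lam, hT, surv_zero_eq]
      field_simp
    · have : cellProb D a none = surv D a 1 D.tau2 := rfl
      simp [lam, hT, this, surv_tau1 D a 0 1]
      simp [surv_one_eq]
      field_simp
  have harg : ∀ i j a, A i j (cellProb D a) / (∑ j', A i j' (cellProb D a)) * lam i (cellProb D a) =
      rate a (D.stress i) j := by
    intro i j a
    rw [hAs, hA, hlam, relRisk]
    have := (hm i a).ne'
    have := (sum_rate_pos hR a (D.stress i)).ne'
    field_simp
  have hℓ : ∀ i j a, ℓ i j (cellProb D a) = -a (j, 0) - a (j, 1) * D.stress i := by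
    intro i j a
    simp only [ℓ, harg, rate, Real.log_exp]
  have hx : D.stress 1 - D.stress 0 ≠ 0 := sub_ne_zero.2 D.stress_ne.symm
  refine ⟨ψ, ?_, ?_⟩
  · have dA : ∀ i j, Differentiable ℝ (A i j) := by
      intro i j
      refine Differentiable.fun_sum fun l _ => ?_
      split_ifs <;> fun_prop
    have dT : Differentiable ℝ T := by
      have := dA 0
      fun_prop
    have hT0 : T (cellProb D a₀) ≠ 0 := by rw [hT]; exact (surv_pos _ _ _ _).ne'
    have hq0 : cellProb D a₀ none ≠ 0 := (cellProb_pos hR D a₀ none).ne'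
    have dlogT : DifferentiableAt ℝ (fun q => Real.log (T q)) (cellProb D a₀) := (dT _).log hT0
    have dlogq : DifferentiableAt ℝ (fun q : Cell L R → ℝ => Real.log (q none)) (cellProb D a₀) :=
      DifferentiableAt.log (by fun_prop) hq0
    have dlam : ∀ i, DifferentiableAt ℝ (lam i) (cellProb D a₀) := by
      intro i
      fin_cases i <;> simp [lam] <;> fun_prop
    have dℓ : ∀ i j, DifferentiableAt ℝ (ℓ i j) (cellProb D a₀) := by
      intro i j
      refine DifferentiableAt.log ?_ (by rw [harg]; exact (rate_pos _ _ _).ne')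
      have h1 := dA i
      have h2 := dlam i
      have h3 : ∑ j', A i j' (cellProb D a₀) ≠ 0 := by rw [hAs]; exact (hm i a₀).ne'
      have h4 : DifferentiableAt ℝ (fun q => ∑ j', A i j' q) (cellProb D a₀) :=
        DifferentiableAt.fun_sum fun j' _ => h1 j' _
      have h5 : DifferentiableAt ℝ (fun q => A i j q / ∑ j', A i j' q) (cellProb D a₀) := by
        have h6 := h1 j
        fun_prop (disch := exact h3)
      exact h5.fun_mul h2
    have dslope : ∀ j, DifferentiableAt ℝ (slope j) (cellProb D a₀) := by
      intro j
      have h0 := dℓ 0 j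
      have h1 := dℓ 1 j
      simp only [slope, div_eq_mul_inv]
      fun_prop
    have h1 := dslope k.1
    have h2 := dℓ 0 k.1
    obtain ⟨k, i⟩ := k
    fin_cases i <;> simp [ψ] <;> fun_prop
  · intro a
    have hs : ∀ j, slope j (cellProb D a) = a (j, 1) := by
      intro j
      simp only [slope, hℓ]
      field_simp
      ring
    obtain ⟨k, i⟩ := k
    fin_cases i
    · simp [ψ, hs, hℓ]
    · simp [ψ, hs]

/-- The Jacobian of the cell probabilities is injective. -/
lemma matW_mulVec_injective (hR : 1 ≤ R) (D : Plan L) (a : Param R) {v : Fin R × Fin 2 → ℝ}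
    (hv : matW D a *ᵥ v = 0) : v = 0 := by
  funext k
  obtain ⟨ψ, hψ, hinv⟩ := exists_leftInverse_coord hR D a k
  have hp : HasFDerivAt (cellProb D) (ContinuousLinearMap.pi fun c => ∑ k, matW D a c k •
      (EuclideanSpace.proj k : Param R →L[ℝ] ℝ)) a :=
    hasFDerivAt_pi.2 fun c => hasPartials_iff.1 (hasPartials_cellProb hR D a c)
  -- By the chain rule the derivative of the left inverse composed with W is the projection to
  -- coordinate `k`, so `W v = 0` forces `v k = 0`.
  have hc := (hψ.hasFDerivAt).comp a hp
  have he : (ψ ∘ cellProb D) = fun a : Param R => a k := funext hinv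
  rw [he] at hc
  have h2 := hc.unique (EuclideanSpace.proj k : Param R →L[ℝ] ℝ).hasFDerivAt
  have h3 := congrArg (fun l => l (WithLp.toLp 2 v)) h2
  have h4 : (ContinuousLinearMap.pi fun c => ∑ k, matW D a c k •
      (EuclideanSpace.proj k : Param R →L[ℝ] ℝ)) (WithLp.toLp 2 v) = 0 := by
    funext c
    simpa [Matrix.mulVec, dotProduct] using congrFun hv c
  simp only [ContinuousLinearMap.comp_apply, h4, map_zero] at h3
  simpa using h3.symm

/-- The quadratic form of J at v is a sum of squares of the entries of W v with positive weights, so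
a kernel vector of J is a kernel vector of the injective W. -/
lemma isUnit_det_matJ (hR : 1 ≤ R) (D : Plan L) (β : ℝ) (a : Param R) :
    IsUnit (matJ D β a).det := by
  rw [isUnit_iff_ne_zero]
  intro h
  obtain ⟨v, hv0, hv⟩ := Matrix.exists_mulVec_eq_zero_iff.2 h
  refine hv0 (matW_mulVec_injective hR D a ?_)
  have h1 : v ⬝ᵥ (matJ D β a *ᵥ v) = ∑ c, cellProb D a c ^ (β - 1) * (matW D a *ᵥ v) c ^ 2 := by
    rw [matJ, ← Matrix.mulVec_mulVec, ← Matrix.mulVec_mulVec, Matrix.dotProduct_mulVec,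
      Matrix.vecMul_transpose, dotProduct]
    refine Finset.sum_congr rfl fun c _ => ?_
    rw [Matrix.mulVec_diagonal]
    ring
  rw [hv, dotProduct_zero] at h1
  have hpos : ∀ c, 0 < cellProb D a c ^ (β - 1) := fun c =>
    Real.rpow_pos_of_pos (cellProb_pos hR D a c) _
  have h2 := (Finset.sum_eq_zero_iff_of_nonneg
    fun c _ => mul_nonneg (hpos c).le (sq_nonneg _)).1 h1.symm
  funext c
  have := h2 c (Finset.mem_univ c)
  simpa [(hpos c).ne'] using this

end Jacobian

/-! ### Separation by the divergence, localisation and linearisation of its minimisers. -/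

section Divergence

variable {L R : ℕ}

/-! ### The density power divergence separates probability vectors -/

/-- Strict Bernoulli inequality for `(x / y) ^ (β + 1)`, multiplied by `y ^ (β + 1) / β`. For `y =
0` the ratio is useless, but only the last summand survives because `β > 0`. -/
lemma dpd_term_pos {β : ℝ} (hβ : 0 < β) {x y : ℝ} (hx : 0 ≤ x) (hy : 0 ≤ y) (hxy : x ≠ y) :
    0 < y ^ (1 + β) - (1 + 1 / β) * (x * y ^ β) + 1 / β * x ^ (β + 1) := by
  rcases hy.eq_or_lt with rfl | hy
  · have hx' : 0 < x := lt_of_le_of_ne hx hxy.symm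
    rw [Real.zero_rpow (by positivity), Real.zero_rpow hβ.ne']
    have : 0 < 1 / β * x ^ (β + 1) := by positivity
    simpa using this
  · have hs : x / y - 1 ≠ 0 := fun h => hxy ((div_eq_one_iff_eq hy.ne').1 (sub_eq_zero.1 h))
    have hb := one_add_mul_self_lt_rpow_one_add (s := x / y - 1)
      (by linarith [div_nonneg hx hy.le]) hs (p := β + 1) (by linarith)
    rw [add_sub_cancel, Real.div_rpow hx hy.le, lt_div_iff₀ (by positivity)] at hb
    have h1 : y ^ (β + 1) = y ^ β * y := by rw [Real.rpow_add hy, Real.rpow_one]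
    have h2 : (1 + (β + 1) * (x / y - 1)) * y ^ (β + 1) =
        (β + 1) * (x * y ^ β) - β * y ^ (β + 1) := by
      rw [h1]; field_simp; ring
    rw [h2] at hb
    have h3 : y ^ (1 + β) - (1 + 1 / β) * (x * y ^ β) + 1 / β * x ^ (β + 1) =
        1 / β * (x ^ (β + 1) - ((β + 1) * (x * y ^ β) - β * y ^ (β + 1))) := by
      rw [add_comm 1 β]; field_simp; ring
    rw [h3]
    exact mul_pos (by positivity) (sub_pos.2 hb)

lemma dpd_term_self {β : ℝ} (hβ : 0 < β) {x : ℝ} (hx : 0 ≤ x) :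
    x ^ (1 + β) - (1 + 1 / β) * (x * x ^ β) + 1 / β * x ^ (β + 1) = 0 := by
  have : x ^ (β + 1) = x * x ^ β := by
    rw [Real.rpow_add_of_nonneg hx hβ.le zero_le_one, Real.rpow_one, mul_comm]
  rw [add_comm 1 β, this]
  ring

lemma dpd_term_nonneg {β : ℝ} (hβ : 0 < β) {x y : ℝ} (hx : 0 ≤ x) (hy : 0 ≤ y) :
    0 ≤ y ^ (1 + β) - (1 + 1 / β) * (x * y ^ β) + 1 / β * x ^ (β + 1) := by
  rcases eq_or_ne x y with rfl | h
  · exact (dpd_term_self hβ hx).ge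
  · exact (dpd_term_pos hβ hx hy h).le

/-- The cellwise bound of the Hellinger distance by the Kullback–Leibler divergence, from `log u ≤ u
- 1` at `u = √y / √x`. The correction `y - x` makes each term nonnegative and sums to zero over
probability vectors. -/
lemma sq_sqrt_sub_sqrt_le {x y : ℝ} (hx : 0 ≤ x) (hy : 0 < y) :
    (√x - √y) ^ 2 ≤ x * Real.log (x / y) + y - x := by
  rcases hx.eq_or_lt with rfl | hx
  · simp [Real.sq_sqrt hy.le]
  · have h1 : Real.log (x / y) = -2 * Real.log (√y / √x) := by
      rw [← Real.sqrt_div' _ hx.le, Real.log_sqrt (by positivity), Real.log_div hx.ne' hy.ne',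
        Real.log_div hy.ne' hx.ne']
      ring
    have h2 := Real.log_le_sub_one_of_pos (x := √y / √x) (by positivity)
    have h3 : x * (√y / √x) = √x * √y := by
      have hs := Real.mul_self_sqrt hx.le
      have : √x ≠ 0 := by positivity
      field_simp
      rw [sq, hs]
    have h4 := mul_le_mul_of_nonneg_left h2 hx.le
    rw [h1]
    have := Real.sq_sqrt hx.le
    have := Real.sq_sqrt hy.le
    nlinarith

/-- The threshold must not depend on `p`, since p(a) ranges over a set that is not compact. For `β =
0` the logarithm blows up at the boundary and the Hellinger bound gives an explicit threshold. For
`β > 0` the cell term is continuous on the closed unit square and positive off the diagonal, so it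
has a positive minimum on the compact part where the coordinates differ by at least `δ`; the other
terms are nonnegative. -/
lemma dpd_separation {β : ℝ} (hβ : 0 ≤ β) {δ : ℝ} (hδ : 0 < δ) :
    ∃ η > 0, ∀ q ∈ stdSimplex ℝ (Cell L R), ∀ p ∈ stdSimplex ℝ (Cell L R), (∀ c, 0 < p c) →
      dpd β q p < η → ∀ c, |q c - p c| < δ := by
  rcases hβ.eq_or_lt with rfl | hβ
  · refine ⟨(δ / 2) ^ 2, by positivity, fun q hq p hp hpos hd c => ?_⟩
    have h1 : (√(q c) - √(p c)) ^ 2 < (δ / 2) ^ 2 := by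
      refine lt_of_le_of_lt ?_ hd
      have h2 : dpd 0 q p = ∑ c, (q c * Real.log (q c / p c) + p c - q c) := by
        simp [dpd, Finset.sum_add_distrib, hq.2, hp.2]
      rw [h2]
      refine (sq_sqrt_sub_sqrt_le (hq.1 c) (hpos c)).trans ?_
      exact Finset.single_le_sum
        (f := fun c => q c * Real.log (q c / p c) + p c - q c)
        (fun c _ => (sq_nonneg _).trans (sq_sqrt_sub_sqrt_le (hq.1 c) (hpos c)))
        (Finset.mem_univ c)
    have h3 : |√(q c) - √(p c)| < δ / 2 := abs_lt_of_sq_lt_sq h1 (by positivity)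
    have hle : ∀ r ∈ stdSimplex ℝ (Cell L R), √(r c) ≤ 1 := fun r hr =>
      Real.sqrt_le_one.2 (hr.2 ▸ Finset.single_le_sum (fun c _ => hr.1 c) (Finset.mem_univ c))
    have h4 : q c - p c = (√(q c) - √(p c)) * (√(q c) + √(p c)) := by
      have := Real.mul_self_sqrt (hq.1 c)
      have := Real.mul_self_sqrt (hp.1 c)
      nlinarith
    rw [h4, abs_mul, abs_of_nonneg (by positivity : 0 ≤ √(q c) + √(p c))]
    have := hle q hq
    have := hle p hp
    nlinarith [abs_nonneg (√(q c) - √(p c)), Real.sqrt_nonneg (q c), Real.sqrt_nonneg (p c)]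
  · let φ : ℝ × ℝ → ℝ := fun z =>
      z.2 ^ (1 + β) - (1 + 1 / β) * (z.1 * z.2 ^ β) + 1 / β * z.1 ^ (β + 1)
    have hφ : Continuous φ := by
      have h1 : Continuous fun z : ℝ × ℝ => z.2 ^ (1 + β) :=
        continuous_snd.rpow_const fun _ => Or.inr (by positivity)
      have h2 : Continuous fun z : ℝ × ℝ => z.2 ^ β :=
        continuous_snd.rpow_const fun _ => Or.inr hβ.le
      have h3 : Continuous fun z : ℝ × ℝ => z.1 ^ (β + 1) :=
        continuous_fst.rpow_const fun _ => Or.inr (by positivity)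
      fun_prop
    let K : Set (ℝ × ℝ) := (Set.Icc 0 1 ×ˢ Set.Icc 0 1) ∩ {z | δ ≤ |z.1 - z.2|}
    have hK : IsCompact K := (isCompact_Icc.prod isCompact_Icc).inter_right
      (isClosed_le continuous_const (by fun_prop))
    have hKpos : ∀ z ∈ K, 0 < φ z := by
      rintro ⟨x, y⟩ ⟨⟨hx, hy⟩, hz⟩
      refine dpd_term_pos hβ hx.1 hy.1 ?_
      intro hxy
      have hz' : δ ≤ |x - y| := hz
      rw [show x = y from hxy, sub_self, abs_zero] at hz'
      linarith
    obtain ⟨η, hη, hmin⟩ : ∃ η > 0, ∀ z ∈ K, η ≤ φ z := by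
      rcases K.eq_empty_or_nonempty with h | h
      · exact ⟨1, one_pos, by simp [h]⟩
      · obtain ⟨z, hz, hz'⟩ := hK.exists_isMinOn h hφ.continuousOn
        exact ⟨φ z, hKpos z hz, fun w hw => hz' hw⟩
    refine ⟨η, hη, fun q hq p hp _ hd c => ?_⟩
    by_contra! hc
    have hle : ∀ r ∈ stdSimplex ℝ (Cell L R), r c ≤ 1 := fun r hr =>
      hr.2 ▸ Finset.single_le_sum (fun c _ => hr.1 c) (Finset.mem_univ c)
    have h1 := hmin (q c, p c) ⟨⟨⟨hq.1 c, hle q hq⟩, ⟨hp.1 c, hle p hp⟩⟩, hc⟩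
    refine absurd hd (not_lt.2 (h1.trans ?_))
    rw [dpd, if_neg hβ.ne']
    exact Finset.single_le_sum (f := fun c => φ (q c, p c))
      (fun c _ => dpd_term_nonneg hβ (hq.1 c) (hp.1 c)) (Finset.mem_univ c)

lemma mul_log_div {x y : ℝ} (hy : 0 < y) :
    x * Real.log (x / y) = x * Real.log x - x * Real.log y := by
  rcases eq_or_ne x 0 with rfl | hx
  · simp
  · rw [Real.log_div hx hy.ne']
    ring

lemma continuous_dpd_left {β : ℝ} (hβ : 0 ≤ β) {p : Cell L R → ℝ} (hp : ∀ c, 0 < p c) :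
    Continuous fun q => dpd β q p := by
  rcases hβ.eq_or_lt with rfl | hβ
  · simp only [dpd, if_true, mul_log_div (hp _)]
    have h : ∀ c, Continuous fun q : Cell L R → ℝ => q c * Real.log (q c) := fun c =>
      Real.continuous_mul_log.comp (continuous_apply c)
    fun_prop
  · simp only [dpd, if_neg hβ.ne']
    have h : ∀ c, Continuous fun q : Cell L R → ℝ => q c ^ (β + 1) := fun c =>
      (continuous_apply c).rpow_const fun _ => Or.inr (by positivity)
    fun_prop

lemma dpd_self {β : ℝ} (hβ : 0 ≤ β) {p : Cell L R → ℝ} (hp : ∀ c, 0 < p c) : dpd β p p = 0 := by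
  rcases hβ.eq_or_lt with rfl | hβ
  · simp [dpd, div_self (hp _).ne']
  · rw [dpd, if_neg hβ.ne']
    exact Finset.sum_eq_zero fun c _ => dpd_term_self hβ (hp c).le

/-! ### Estimating equations -/

/-- One formula covers both divergences. For `β = 0` differentiation gives only the terms containing
`q`; the missing term is the column sum of W, which is zero. -/
lemma hasPartials_dpd (hR : 1 ≤ R) (D : Plan L) {β : ℝ} (hβ : 0 ≤ β) (q : Cell L R → ℝ)
    (a : Param R) :
    HasPartials (fun a => dpd β q (cellProb D a)) (fun k => (1 + β) *
      ∑ c, matW D a c k * cellProb D a c ^ (β - 1) * (cellProb D a c - q c)) a := by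
  have hpos := cellProb_pos hR D a
  have hW := hasPartials_cellProb hR D a
  rcases hβ.eq_or_lt with rfl | hβ
  · simp only [dpd, if_true, mul_log_div (cellProb_pos hR D _ _)]
    refine (HasPartials.sum Finset.univ fun c _ =>
      (hasPartials_const (q c * Real.log (q c)) a).sub
        ((HasPartials.comp (Real.hasDerivAt_log (hpos c).ne') (hW c)).const_mul
          (q c))).congr_partials fun k => ?_
    have h : ∀ c, matW D a c k * cellProb D a c ^ ((0 : ℝ) - 1) * (cellProb D a c - q c) =
        matW D a c k + (0 - q c * ((cellProb D a c)⁻¹ * matW D a c k)) := by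
      intro c
      have := (hpos c).ne'
      rw [zero_sub, Real.rpow_neg_one]
      field_simp
      ring
    simp only [h, Finset.sum_add_distrib, sum_matW hR]
    ring
  · simp only [dpd, if_neg hβ.ne']
    refine (HasPartials.sum Finset.univ fun c _ =>
      ((HasPartials.comp (Real.hasDerivAt_rpow_const (p := 1 + β) (Or.inl (hpos c).ne'))
        (hW c)).sub (((HasPartials.comp (Real.hasDerivAt_rpow_const (p := β)
          (Or.inl (hpos c).ne')) (hW c)).const_mul (q c)).const_mul (1 + 1 / β))).add
            (hasPartials_const (1 / β * q c ^ (β + 1)) a)).congr_partials fun k => ?_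
    rw [Finset.mul_sum]
    refine Finset.sum_congr rfl fun c _ => ?_
    have h : cellProb D a c ^ (1 + β - 1) = cellProb D a c ^ (β - 1) * cellProb D a c := by
      rw [← Real.rpow_add_one (hpos c).ne']
      ring_nf
    rw [h]
    field_simp
    ring

lemma continuous_dpd_cellProb (hR : 1 ≤ R) (D : Plan L) {β : ℝ} (hβ : 0 ≤ β) (q : Cell L R → ℝ) :
    Continuous fun a => dpd β q (cellProb D a) :=
  continuous_iff_continuousAt.2 fun a => (hasPartials_dpd hR D hβ q a).continuousAt

lemma IsMDPDE.estimating_eq (hR : 1 ≤ R) {D : Plan L} {β : ℝ} (hβ : 0 ≤ β) {q : Cell L R → ℝ}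
    {a : Param R} (h : IsMDPDE D β q a) (k : Fin R × Fin 2) :
    ∑ c, matW D a c k * cellProb D a c ^ (β - 1) * (cellProb D a c - q c) = 0 := by
  have h1 := (hasPartials_dpd hR D hβ q a).eq_zero_of_isLocalMin
    (Filter.Eventually.of_forall h) k
  exact (mul_eq_zero.1 h1).resolve_left (by positivity)

/-! ### Existence and localisation of the minimiser -/

lemma cellProb_mem_stdSimplex (hR : 1 ≤ R) (D : Plan L) (a : Param R) :
    cellProb D a ∈ stdSimplex ℝ (Cell L R) :=
  ⟨fun c => (cellProb_pos hR D a c).le, sum_cellProb hR D a⟩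

/-- Continuity of the left inverse at the true cell probabilities. The conclusion holds for all `a`
in the unbounded parameter space, not just for those already near `a₀`. -/
lemma dist_lt_of_cellProb_close (hR : 1 ≤ R) (D : Plan L) (a₀ : Param R) {ε : ℝ} (hε : 0 < ε) :
    ∃ δ > 0, ∀ a, (∀ c, |cellProb D a c - cellProb D a₀ c| < δ) → dist a a₀ < ε := by
  choose ψ hψ hinv using exists_leftInverse_coord hR D a₀
  have hc : ContinuousAt (fun q => (WithLp.toLp 2 fun k => ψ k q : Param R)) (cellProb D a₀) :=
    (PiLp.continuous_toLp 2 _).continuousAt.comp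
      (continuousAt_pi.2 fun k => (hψ k).continuousAt)
  obtain ⟨δ, hδ, h⟩ := Metric.continuousAt_iff.1 hc ε hε
  refine ⟨δ, hδ, fun a ha => ?_⟩
  have := h (x := cellProb D a) ((dist_pi_lt_iff hδ).2 fun c => by simpa [Real.dist_eq] using ha c)
  simpa only [hinv] using this

/-- A parameter that does no worse than `a₀` has p(a) near q by separation, hence near p(a₀), hence
is itself near `a₀`. This confines all minimisers, and gives existence by compactness. -/
lemma exists_isMDPDE_near (hR : 1 ≤ R) (D : Plan L) (a₀ : Param R) {β : ℝ} (hβ : 0 ≤ β) {ε : ℝ}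
    (hε : 0 < ε) :
    ∃ δ > 0, ∀ q ∈ stdSimplex ℝ (Cell L R), dist q (cellProb D a₀) < δ →
      (∃ a, IsMDPDE D β q a) ∧ ∀ a, IsMDPDE D β q a → dist a a₀ < ε := by
  obtain ⟨δ₁, hδ₁, h1⟩ := dist_lt_of_cellProb_close hR D a₀ hε
  obtain ⟨η, hη, h2⟩ := dpd_separation (L := L) (R := R) hβ (half_pos hδ₁)
  have hp0 := cellProb_pos hR D a₀
  obtain ⟨δ₂, hδ₂, h3⟩ := Metric.continuousAt_iff.1
    (continuous_dpd_left hβ hp0).continuousAt η hη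
  refine ⟨min δ₂ (δ₁ / 2), lt_min hδ₂ (half_pos hδ₁), fun q hq hd => ?_⟩
  have hq0 : dpd β q (cellProb D a₀) < η := by
    have := h3 (hd.trans_le (min_le_left _ _))
    rw [dpd_self hβ hp0, Real.dist_eq, sub_zero] at this
    exact lt_of_abs_lt this
  have hloc : ∀ a, dpd β q (cellProb D a) ≤ dpd β q (cellProb D a₀) → dist a a₀ < ε := by
    intro a ha
    refine h1 a fun c => ?_
    have e1 := h2 q hq _ (cellProb_mem_stdSimplex hR D a) (cellProb_pos hR D a)
      (ha.trans_lt hq0) c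
    have e2 : |q c - cellProb D a₀ c| < δ₁ / 2 := by
      rw [← Real.dist_eq]
      exact (dist_le_pi_dist q _ c).trans_lt (hd.trans_le (min_le_right _ _))
    rw [abs_lt] at *
    constructor <;> linarith [e1.1, e1.2, e2.1, e2.2]
  refine ⟨?_, fun a ha => hloc a (ha a₀)⟩
  -- A minimiser over the closed ball is global: a point that beats or ties `a₀` lies in the ball,
  -- and any other point is worse than the centre.
  obtain ⟨a, ha, hmin⟩ := (isCompact_closedBall a₀ ε).exists_isMinOn
    ⟨a₀, Metric.mem_closedBall_self hε.le⟩ (continuous_dpd_cellProb hR D hβ q).continuousOn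
  refine ⟨a, fun b => ?_⟩
  by_cases hb : dpd β q (cellProb D b) ≤ dpd β q (cellProb D a₀)
  · exact hmin (Metric.mem_closedBall.2 (hloc b hb).le)
  · exact (hmin (Metric.mem_closedBall_self hε.le)).trans (not_le.1 hb).le

lemma exists_allObserved_near (hR : 1 ≤ R) (D : Plan L) (a₀ : Param R) :
    ∃ δ > 0, ∀ q : Cell L R → ℝ, dist q (cellProb D a₀) < δ → AllObserved D q := by
  have h : ∀ᶠ q in 𝓝 (cellProb D a₀), ∀ c, 0 < q c :=
    eventually_all.2 fun c => (continuous_apply c).continuousAt.eventually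
      (lt_mem_nhds (cellProb_pos hR D a₀ c))
  obtain ⟨δ, hδ, hδ'⟩ := Metric.eventually_nhds_iff.1 h
  refine ⟨δ, hδ, fun q hq i j => ?_⟩
  have hpos := D.changeIdx_pos
  have hlt := D.changeIdx_lt
  simp only [Fin.lt_def, Fin.val_last, Fin.val_zero] at hpos hlt
  fin_cases i
  -- Since the change index is strictly interior, the first interval always belongs to the first
  -- stage and the last interval to the second.
  · refine ⟨⟨0, by omega⟩, (D.stage_eq_zero_iff _).2 ?_, hδ' hq _⟩
    simp only [Fin.le_def, Fin.val_succ]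
    omega
  · refine ⟨⟨L - 1, by omega⟩, (D.stage_eq_one_iff _).2 ?_, hδ' hq _⟩
    simp only [Fin.le_def, Fin.val_castSucc]
    omega

/-! ### Linearisation of the estimator -/

/-- Influence vector of the functional of the minimum density power divergence estimator whose
gradient is `u`. -/
def influence (D : Plan L) (β : ℝ) (a : Param R) (u : Fin R × Fin 2 → ℝ) (c : Cell L R) : ℝ :=
  cellProb D a c ^ (β - 1) * (matW D a *ᵥ ((matJ D β a)⁻¹ᵀ *ᵥ u)) c

lemma norm_le_sum_abs {ι : Type*} [Fintype ι] (x : EuclideanSpace ℝ ι) : ‖x‖ ≤ ∑ i, |x i| := by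
  rw [EuclideanSpace.norm_eq]
  refine Real.sqrt_le_iff.2 ⟨Finset.sum_nonneg fun i _ => abs_nonneg _, ?_⟩
  exact Finset.sum_sq_le_sq_sum_of_nonneg fun i _ => norm_nonneg (x i)

/-- Testing the linearised estimating equation against `w = (J⁻¹)ᵀ u` isolates the direction `u`:
the parameter part becomes `w · J y = u · y`, and the data part is by definition the influence
vector applied to `x`. -/
lemma influence_dotProduct (hR : 1 ≤ R) (D : Plan L) (β : ℝ) (a : Param R)
    (u y : Fin R × Fin 2 → ℝ) (x : Cell L R → ℝ) :
    ∑ k, ((matJ D β a)⁻¹ᵀ *ᵥ u) k * (∑ c, matW D a c k * cellProb D a c ^ (β - 1) *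
      (∑ k', matW D a c k' * y k' - x c)) = u ⬝ᵥ y - influence D β a u ⬝ᵥ x := by
  set w := (matJ D β a)⁻¹ᵀ *ᵥ u with hw
  have h1 : ∑ k, w k * (∑ c, matW D a c k * cellProb D a c ^ (β - 1) *
      (∑ k', matW D a c k' * y k' - x c)) =
      w ⬝ᵥ (matJ D β a *ᵥ y) - influence D β a u ⬝ᵥ x := by
    have e1 : matJ D β a *ᵥ y = fun k => ∑ c, matW D a c k * (cellProb D a c ^ (β - 1) *
        ∑ k', matW D a c k' * y k') := by
      funext k
      rw [matJ, ← Matrix.mulVec_mulVec, ← Matrix.mulVec_mulVec]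
      simp only [Matrix.mulVec, dotProduct, Matrix.transpose_apply, Matrix.diagonal_apply]
      simp
    have e2 : influence D β a u ⬝ᵥ x = ∑ k, w k * ∑ c, matW D a c k *
        (cellProb D a c ^ (β - 1) * x c) := by
      have e3 : ∀ c, influence D β a u c = ∑ k, cellProb D a c ^ (β - 1) * (matW D a c k * w k) :=
        fun c => Finset.mul_sum _ _ _
      simp only [dotProduct, e3, Finset.mul_sum, Finset.sum_mul]
      rw [Finset.sum_comm]
      exact Finset.sum_congr rfl fun k _ => Finset.sum_congr rfl fun c _ => by ring
    rw [e1, e2, dotProduct, ← Finset.sum_sub_distrib]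
    refine Finset.sum_congr rfl fun k _ => ?_
    rw [← mul_sub, ← Finset.sum_sub_distrib]
    congr 1
    exact Finset.sum_congr rfl fun c _ => by ring
  rw [h1, hw, Matrix.mulVec_transpose, ← Matrix.dotProduct_mulVec, Matrix.mulVec_mulVec,
    Matrix.nonsing_inv_mul _ (isUnit_det_matJ hR D β a), Matrix.one_mulVec]

/-- The filter consists of pairs (q, minimiser) near the truth, so no minimiser is selected as a
function of q. The error is still measured by both increments; `mdpde_isBigO` then removes the
parameter increment. -/
lemma mdpde_isLittleO_aux (hR : 1 ≤ R) (D : Plan L) (a₀ : Param R) {β : ℝ} (hβ : 0 ≤ β)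
    (u : Fin R × Fin 2 → ℝ) :
    (fun z : (Cell L R → ℝ) × Param R =>
      u ⬝ᵥ (⇑(z.2 - a₀)) - influence D β a₀ u ⬝ᵥ (z.1 - cellProb D a₀))
      =o[𝓝 (cellProb D a₀, a₀) ⊓ 𝓟 {z | IsMDPDE D β z.1 z.2}]
      fun z => ‖z.2 - a₀‖ + ‖z.1 - cellProb D a₀‖ := by
  set l := 𝓝 (cellProb D a₀, a₀) ⊓ 𝓟 {z : (Cell L R → ℝ) × Param R | IsMDPDE D β z.1 z.2}
  set n : (Cell L R → ℝ) × Param R → ℝ := fun z => ‖z.2 - a₀‖ + ‖z.1 - cellProb D a₀‖ with hn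
  have hl2 : Tendsto Prod.snd l (𝓝 a₀) := (continuous_snd.tendsto _).mono_left inf_le_left
  have ha : (fun z : (Cell L R → ℝ) × Param R => z.2 - a₀) =O[l] n :=
    IsBigO.of_bound 1 (Eventually.of_forall fun z => by
      simp only [hn, Real.norm_eq_abs]
      rw [abs_of_nonneg (by positivity)]
      linarith [norm_nonneg (z.1 - cellProb D a₀)])
  have hq : ∀ c, (fun z : (Cell L R → ℝ) × Param R => z.1 c - cellProb D a₀ c) =O[l] n := fun c =>
    IsBigO.of_bound 1 (Eventually.of_forall fun z => by
      have h1 := norm_le_pi_norm (z.1 - cellProb D a₀) c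
      simp only [Pi.sub_apply] at h1
      rw [hn, Real.norm_eq_abs (_ + _), abs_of_nonneg (by positivity)]
      linarith [norm_nonneg (z.2 - a₀)])
  have hlin : ∀ c, (fun z : (Cell L R → ℝ) × Param R => cellProb D z.2 c - cellProb D a₀ c -
      ∑ k, matW D a₀ c k * (z.2 - a₀) k) =o[l] n := by
    intro c
    have h1 := ((hasPartials_iff.1 (hasPartials_cellProb hR D a₀ c)).isLittleO).comp_tendsto hl2
    refine IsLittleO.trans_isBigO ?_ ha
    simpa [Function.comp_def] using h1
  have hp : ∀ c, (fun z : (Cell L R → ℝ) × Param R => cellProb D z.2 c - z.1 c) =O[l] n := by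
    intro c
    have h1 := ((hasPartials_iff.1 (hasPartials_cellProb hR D a₀ c)).isBigO_sub).comp_tendsto hl2
    refine ((h1.trans ha).sub (hq c)).congr_left fun z => ?_
    simp
  have hM : ∀ c k, (fun z : (Cell L R → ℝ) × Param R =>
      matW D a₀ c k * cellProb D a₀ c ^ (β - 1) - matW D z.2 c k * cellProb D z.2 c ^ (β - 1))
      =o[l] fun _ => (1 : ℝ) := by
    intro c k
    rw [isLittleO_one_iff]
    have hcont : ContinuousAt (fun a => matW D a c k * cellProb D a c ^ (β - 1)) a₀ :=
      (continuous_matW hR D c k).continuousAt.mul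
        ((continuous_cellProb hR D c).continuousAt.rpow_const
          (Or.inl (cellProb_pos hR D a₀ c).ne'))
    have := (hcont.tendsto.comp hl2).const_sub (matW D a₀ c k * cellProb D a₀ c ^ (β - 1))
    simpa using this
  have hres : ∀ k, (fun z : (Cell L R → ℝ) × Param R => ∑ c, matW D a₀ c k *
      cellProb D a₀ c ^ (β - 1) * (∑ k', matW D a₀ c k' * (z.2 - a₀) k' -
        (z.1 - cellProb D a₀) c)) =o[l] n := by
    intro k
    -- The linearised equation at `a₀` minus the exact equation at the minimiser, whose value is
    -- zero. The error is the change of the coefficients times p(a) - q, which is o(1) times O(n),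
    -- and minus the linearisation error of p.
    have h1 : (fun z : (Cell L R → ℝ) × Param R => ∑ c,
        ((matW D a₀ c k * cellProb D a₀ c ^ (β - 1) - matW D z.2 c k * cellProb D z.2 c ^ (β - 1)) *
          (cellProb D z.2 c - z.1 c) - matW D a₀ c k * cellProb D a₀ c ^ (β - 1) *
            (cellProb D z.2 c - cellProb D a₀ c - ∑ k, matW D a₀ c k * (z.2 - a₀) k))) =o[l] n :=
      IsLittleO.fun_sum fun c _ => IsLittleO.sub
        (by simpa using (hM c k).mul_isBigO (hp c)) ((hlin c).const_mul_left _)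
    refine h1.congr' ?_ EventuallyEq.rfl
    filter_upwards [mem_inf_of_right (mem_principal_self _)] with z hz
    have h2 := IsMDPDE.estimating_eq hR hβ hz k
    refine Eq.trans ?_ (sub_zero _)
    rw [← h2, ← Finset.sum_sub_distrib]
    refine Finset.sum_congr rfl fun c _ => ?_
    simp only [Pi.sub_apply]
    ring
  have hfin : (fun z : (Cell L R → ℝ) × Param R => ∑ k, ((matJ D β a₀)⁻¹ᵀ *ᵥ u) k *
      (∑ c, matW D a₀ c k * cellProb D a₀ c ^ (β - 1) *
        (∑ k', matW D a₀ c k' * (z.2 - a₀) k' - (z.1 - cellProb D a₀) c))) =o[l] n :=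
    IsLittleO.fun_sum fun k _ => (hres k).const_mul_left _
  exact hfin.congr_left fun z => influence_dotProduct hR D β a₀ u _ _

/-- Applying the expansion to each coordinate bounds the parameter increment by a multiple of the
data increment plus a small fraction of itself, which can be absorbed. -/
lemma mdpde_isBigO (hR : 1 ≤ R) (D : Plan L) (a₀ : Param R) {β : ℝ} (hβ : 0 ≤ β) :
    (fun z : (Cell L R → ℝ) × Param R => z.2 - a₀)
      =O[𝓝 (cellProb D a₀, a₀) ⊓ 𝓟 {z | IsMDPDE D β z.1 z.2}] fun z => z.1 - cellProb D a₀ := by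
  set l := 𝓝 (cellProb D a₀, a₀) ⊓ 𝓟 {z : (Cell L R → ℝ) × Param R | IsMDPDE D β z.1 z.2}
  let v : Fin R × Fin 2 → Cell L R → ℝ := fun k => influence D β a₀ (Pi.single k 1)
  have h1 := fun k => mdpde_isLittleO_aux hR D a₀ hβ (Pi.single k 1)
  have hs : (fun z : (Cell L R → ℝ) × Param R => ∑ k, |(z.2 - a₀) k - v k ⬝ᵥ (z.1 - cellProb D a₀)|)
      =o[l] fun z => ‖z.2 - a₀‖ + ‖z.1 - cellProb D a₀‖ :=
    IsLittleO.fun_sum fun k _ => by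
      simpa only [Real.norm_eq_abs, single_dotProduct, one_mul] using (h1 k).norm_left
  have hv : (fun z : (Cell L R → ℝ) × Param R => ∑ k, |v k ⬝ᵥ (z.1 - cellProb D a₀)|)
      =O[l] fun z => z.1 - cellProb D a₀ := by
    refine IsBigO.fun_sum fun k _ => ?_
    have : (fun z : (Cell L R → ℝ) × Param R => v k ⬝ᵥ (z.1 - cellProb D a₀))
        =O[l] fun z => z.1 - cellProb D a₀ := by
      simp only [dotProduct]
      refine IsBigO.fun_sum fun c _ => IsBigO.const_mul_left ?_ _
      exact IsBigO.of_bound 1 (Eventually.of_forall fun z => by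
        simpa using norm_le_pi_norm (z.1 - cellProb D a₀) c)
    simpa using this.norm_left
  obtain ⟨C, hC⟩ := hv.bound
  -- From ‖Δa‖ ≤ (‖Δa‖ + ‖Δq‖) / 2 + C ‖Δq‖ one gets ‖Δa‖ ≤ (1 + 2C) ‖Δq‖.
  refine IsBigO.of_bound (1 + 2 * C) ?_
  filter_upwards [hC, hs.bound (half_pos one_pos)] with z hz1 hz2
  have h2 : ‖z.2 - a₀‖ ≤ ∑ k, |(z.2 - a₀) k - v k ⬝ᵥ (z.1 - cellProb D a₀)| +
      ∑ k, |v k ⬝ᵥ (z.1 - cellProb D a₀)| := by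
    refine (norm_le_sum_abs _).trans ?_
    rw [← Finset.sum_add_distrib]
    refine Finset.sum_le_sum fun k _ => ?_
    simpa using abs_add_le ((z.2 - a₀) k - v k ⬝ᵥ (z.1 - cellProb D a₀))
      (v k ⬝ᵥ (z.1 - cellProb D a₀))
  rw [Real.norm_eq_abs, abs_of_nonneg (Finset.sum_nonneg fun _ _ => abs_nonneg _)] at hz1 hz2
  rw [Real.norm_eq_abs, abs_of_nonneg (by positivity)] at hz2
  linarith

lemma mdpde_isLittleO (hR : 1 ≤ R) (D : Plan L) (a₀ : Param R) {β : ℝ} (hβ : 0 ≤ β)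
    {g : Param R → ℝ} {u : Fin R × Fin 2 → ℝ} (hg : HasPartials g u a₀) :
    (fun z : (Cell L R → ℝ) × Param R =>
      g z.2 - g a₀ - influence D β a₀ u ⬝ᵥ (z.1 - cellProb D a₀))
      =o[𝓝 (cellProb D a₀, a₀) ⊓ 𝓟 {z | IsMDPDE D β z.1 z.2}] fun z => z.1 - cellProb D a₀ := by
  have hO := mdpde_isBigO hR D a₀ hβ
  have hl2 : Tendsto Prod.snd (𝓝 (cellProb D a₀, a₀) ⊓
      𝓟 {z : (Cell L R → ℝ) × Param R | IsMDPDE D β z.1 z.2}) (𝓝 a₀) :=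
    (continuous_snd.tendsto _).mono_left inf_le_left
  have h1 := (((hasPartials_iff.1 hg).isLittleO).comp_tendsto hl2).trans_isBigO hO
  have h2 := (mdpde_isLittleO_aux hR D a₀ hβ u).trans_isBigO
    (hO.norm_left.add (isBigO_refl _ _).norm_left)
  refine (h1.add h2).congr_left fun z => ?_
  simp [dotProduct]

/-- First-order expansion of a smooth functional of the minimum density power divergence estimator
around the true cell probabilities. -/
theorem mdpde_expansion (hR : 1 ≤ R) (D : Plan L) (a₀ : Param R) {β : ℝ} (hβ : 0 ≤ β)
    {g : Param R → ℝ} {u : Fin R × Fin 2 → ℝ} (hg : HasPartials g u a₀) {ε : ℝ} (hε : 0 < ε) :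
    ∃ δ > 0, ∀ q ∈ stdSimplex ℝ (Cell L R), dist q (cellProb D a₀) < δ →
      AllObserved D q ∧ (∃ a, IsMDPDE D β q a) ∧ ∀ a, IsMDPDE D β q a →
        |g a - g a₀ - influence D β a₀ u ⬝ᵥ (q - cellProb D a₀)| ≤ ε * ‖q - cellProb D a₀‖ := by
  have h1 := (mdpde_isLittleO hR D a₀ hβ hg).bound hε
  rw [eventually_inf_principal, Metric.eventually_nhds_iff] at h1
  obtain ⟨δ₁, hδ₁, h1⟩ := h1
  obtain ⟨δ₂, hδ₂, h2⟩ := exists_isMDPDE_near hR D a₀ hβ hδ₁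
  obtain ⟨δ₃, hδ₃, h3⟩ := exists_allObserved_near hR D a₀
  refine ⟨min δ₁ (min δ₂ δ₃), by positivity, fun q hq hd => ?_⟩
  obtain ⟨hd1, hd2, hd3⟩ : dist q _ < δ₁ ∧ dist q _ < δ₂ ∧ dist q _ < δ₃ := by
    simpa [lt_min_iff] using hd
  obtain ⟨hex, hloc⟩ := h2 q hq hd2
  refine ⟨h3 q hd3, hex, fun a ha => ?_⟩
  have := h1 (y := (q, a)) (by rw [Prod.dist_eq]; exact max_lt hd1 (hloc a ha)) ha
  simpa using this

end Divergence

/-! ### Law of a single unit: competing risks and cell membership. -/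

section Units

open Set (Iic Ioc Ici Ioi Iio Icc)

variable {L R : ℕ} {Ω : Type*} [MeasurableSpace Ω] {μ : Measure Ω} [IsProbabilityMeasure μ]

/-! ### Competing risks with locally exponential lifetimes -/

lemma lintegral_Ioc_exp (α : ℝ) {r : ℝ} (hr : 0 < r) {s t : ℝ} (hst : s ≤ t) :
    ∫⁻ u in Ioc s t, ENNReal.ofReal (r * Real.exp (-(α + r * u))) =
      ENNReal.ofReal (Real.exp (-(α + r * s)) - Real.exp (-(α + r * t))) := by
  have hc : Continuous fun u => r * Real.exp (-(α + r * u)) := by fun_prop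
  rw [← ofReal_integral_eq_lintegral_ofReal (hc.integrableOn_Ioc)
    (Eventually.of_forall fun u => by positivity), ← intervalIntegral.integral_of_le hst,
    intervalIntegral.integral_eq_sub_of_hasDerivAt (f := fun u => -Real.exp (-(α + r * u)))
      (fun u _ => ?_) (hc.intervalIntegrable _ _)]
  · ring_nf
  · have h : HasDerivAt (fun u => -(α + r * u)) (-(r * 1)) u :=
      (((hasDerivAt_id u).const_mul r).const_add α).neg
    convert! h.exp.neg using 1
    ring

/-- Only a local density is needed: a distribution function of exponential form on `[s, t]`
determines the law on `(s, t]`, whatever happens outside. -/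
lemma restrict_Ioc_eq_withDensity {ν : Measure ℝ} [IsProbabilityMeasure ν] {α r s t : ℝ}
    (hr : 0 < r) (hst : s ≤ t)
    (hν : ∀ u ∈ Icc s t, ν.real (Iic u) = 1 - Real.exp (-(α + r * u))) :
    ν.restrict (Ioc s t) = (volume.restrict (Ioc s t)).withDensity
      fun u => ENNReal.ofReal (r * Real.exp (-(α + r * u))) := by
  refine Measure.ext_of_Iic _ _ fun x => ?_
  rw [withDensity_apply _ measurableSet_Iic, Measure.restrict_restrict measurableSet_Iic,
    Measure.restrict_apply measurableSet_Iic]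
  have hI : Iic x ∩ Ioc s t = Ioc s (min x t) := by
    ext u; simp [and_comm, and_assoc, and_left_comm]
  rw [hI]
  rcases le_total s (min x t) with h | h
  · rw [lintegral_Ioc_exp α hr h, ← ENNReal.ofReal_toReal (measure_ne_top ν _)]
    congr 1
    have h1 : ν.real (Ioc s (min x t)) = ν.real (Iic (min x t)) - ν.real (Iic s) := by
      rw [← Set.Iic_sdiff_Iic, measureReal_sdiff (Set.Iic_subset_Iic.2 h) measurableSet_Iic]
    change ν.real _ = _
    rw [h1, hν _ ⟨h, min_le_right _ _⟩, hν _ ⟨le_rfl, hst⟩]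
    ring
  · simp [Set.Ioc_eq_empty (not_lt.2 h)]

lemma measure_singleton_eq_zero {ν : Measure ℝ} [IsProbabilityMeasure ν] {α r s t : ℝ}
    (hr : 0 < r) (hν : ∀ u ∈ Icc s t, ν.real (Iic u) = 1 - Real.exp (-(α + r * u)))
    {u : ℝ} (hu : u ∈ Ioc s t) : ν {u} = 0 := by
  have h := restrict_Ioc_eq_withDensity hr (hu.1.le.trans hu.2) hν
  have h1 : ν.restrict (Ioc s t) {u} = ν {u} := by
    rw [Measure.restrict_apply (measurableSet_singleton u),
      Set.inter_eq_left.2 (Set.singleton_subset_iff.2 hu)]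
  rw [← h1, h]
  exact withDensity_absolutelyContinuous _ _ (by simp)

/-- Probability that the risk `j` causes a failure in `(s, t]`, when all cumulative hazards are
affine on `[s, t]`. -/
lemma measureReal_competing {X : Fin R → Ω → ℝ} (hX : ∀ j, Measurable (X j)) (hind : iIndepFun X μ)
    {s t : ℝ} (hst : s ≤ t) {α r : Fin R → ℝ} (hr : ∀ j, 0 < r j)
    (hlaw : ∀ j, ∀ u ∈ Icc s t, μ.real {ω | X j ω ≤ u} = 1 - Real.exp (-(α j + r j * u)))
    (j : Fin R) :
    μ.real {ω | s < X j ω ∧ X j ω ≤ t ∧ ∀ j', X j ω ≤ X j' ω} =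
      r j / (∑ j', r j') * (Real.exp (-∑ j', (α j' + r j' * s)) -
        Real.exp (-∑ j', (α j' + r j' * t))) := by
  classical
  have hprob : ∀ j, IsProbabilityMeasure (μ.map (X j)) := fun j =>
    Measure.isProbabilityMeasure_map (hX j).aemeasurable
  have hν : ∀ j, ∀ u ∈ Icc s t, (μ.map (X j)).real (Iic u) = 1 - Real.exp (-(α j + r j * u)) := by
    intro j u hu
    rw [map_measureReal_apply (hX j) measurableSet_Iic, ← hlaw j u hu]
    rfl
  have hrs : 0 < ∑ j', r j' := Finset.sum_pos (fun j _ => hr j) ⟨j, Finset.mem_univ j⟩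
  let S := Finset.univ.erase j
  let Y : Ω → S → ℝ := fun ω i => X i ω
  have hY : Measurable Y := measurable_pi_lambda _ fun i => hX i
  have hXY : IndepFun (X j) Y μ := by
    have h1 := hind.indepFun_finset {j} S (by simp [S]) hX
    exact h1.comp (φ := fun f : ({j} : Finset (Fin R)) → ℝ => f ⟨j, by simp⟩) (ψ := id)
      (measurable_pi_apply _) measurable_id
  have hmap := (indepFun_iff_map_prod_eq_prod_map_map (hX j).aemeasurable hY.aemeasurable).1 hXY
  have hYprob : IsProbabilityMeasure (μ.map Y) :=
    Measure.isProbabilityMeasure_map hY.aemeasurable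
  let A : Set (ℝ × (S → ℝ)) := {z | z.1 ∈ Ioc s t} ∩ ⋂ i, {z | z.1 ≤ z.2 i}
  have hA : MeasurableSet A := (measurable_fst measurableSet_Ioc).inter
    (MeasurableSet.iInter fun i => measurableSet_le measurable_fst
      ((measurable_pi_apply i).comp measurable_snd))
  have hset : {ω | s < X j ω ∧ X j ω ≤ t ∧ ∀ j', X j ω ≤ X j' ω} =
      (fun ω => (X j ω, Y ω)) ⁻¹' A := by
    ext ω
    simp only [Set.mem_ofPred_eq, A, Set.mem_preimage, Set.mem_inter_iff, Set.mem_Ioc,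
      Set.mem_iInter, Y, and_assoc]
    refine and_congr_right fun _ => and_congr_right fun _ => ⟨fun h i => h i, fun h j' => ?_⟩
    rcases eq_or_ne j' j with rfl | hj
    · exact le_rfl
    · exact h ⟨j', by simp [S, hj]⟩
  -- If risk `j` strikes at `u`, the others must last at least to `u`, and independence turns this
  -- into a product of survival functions. The weak inequality costs nothing, as the laws have no
  -- atom at `u`.
  have hsec : ∀ u ∈ Ioc s t, μ.map Y (Prod.mk u ⁻¹' A) =
      ENNReal.ofReal (Real.exp (-∑ i ∈ S, (α i + r i * u))) := by
    intro u hu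
    have h1 : Y ⁻¹' (Prod.mk u ⁻¹' A) = ⋂ i ∈ S, X i ⁻¹' Ici u := by
      ext ω
      simp [A, Y, hu.1, hu.2]
    rw [Measure.map_apply hY (measurable_prodMk_left hA), h1,
      hind.meas_biInter fun i _ => ⟨_, measurableSet_Ici, rfl⟩, ← Finset.sum_neg_distrib,
      Real.exp_sum, ENNReal.ofReal_prod_of_nonneg fun i _ => (Real.exp_pos _).le]
    refine Finset.prod_congr rfl fun i _ => ?_
    have hp := hprob i
    rw [← Measure.map_apply (hX i) measurableSet_Ici,
      ← measure_congr (Ioi_ae_eq_Ici' (measure_singleton_eq_zero (hr i) (hν i) hu)),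
      ← Set.compl_Iic, ← ENNReal.ofReal_toReal (measure_ne_top (μ.map (X i)) _)]
    congr 1
    change (μ.map (X i)).real _ = _
    rw [probReal_compl_eq_one_sub measurableSet_Iic, hν i u ⟨hu.1.le, hu.2⟩]
    ring
  have hmain : μ {ω | s < X j ω ∧ X j ω ≤ t ∧ ∀ j', X j ω ≤ X j' ω} =
      ENNReal.ofReal (r j / (∑ j', r j') * (Real.exp (-∑ j', (α j' + r j' * s)) -
        Real.exp (-∑ j', (α j' + r j' * t)))) := by
    rw [hset, ← Measure.map_apply ((hX j).prodMk hY) hA, hmap, Measure.prod_apply hA]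
    have h1 : ∀ u, μ.map Y (Prod.mk u ⁻¹' A) = (Ioc s t).indicator
        (fun u => ENNReal.ofReal (Real.exp (-∑ i ∈ S, (α i + r i * u)))) u := by
      intro u
      by_cases hu : u ∈ Ioc s t
      · rw [Set.indicator_of_mem hu, hsec u hu]
      · rw [Set.indicator_of_notMem hu]
        have : Prod.mk u ⁻¹' A = ∅ := by
          ext y
          simp only [Set.mem_preimage, Set.mem_empty_iff_false, iff_false]
          exact fun h => hu h.1
        rw [this, measure_empty]
    have hp := hprob j
    rw [lintegral_congr h1, lintegral_indicator measurableSet_Ioc,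
      restrict_Ioc_eq_withDensity (hr j) hst (hν j),
      lintegral_withDensity_eq_lintegral_mul _ (by fun_prop) (by fun_prop)]
    -- The density of risk `j` times the survival of the others is the density of the minimum times
    -- the constant share of risk `j` in the total rate. This constancy is where exponentiality
    -- enters.
    have h2 : ∀ u, ((fun u => ENNReal.ofReal (r j * Real.exp (-(α j + r j * u)))) *
        fun u => ENNReal.ofReal (Real.exp (-∑ i ∈ S, (α i + r i * u)))) u =
        ENNReal.ofReal (r j / ∑ j', r j') * ENNReal.ofReal ((∑ j', r j') *
          Real.exp (-(∑ j', α j' + (∑ j', r j') * u))) := by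
      intro u
      have h3 : ∑ j', α j' + (∑ j', r j') * u = (α j + r j * u) + ∑ i ∈ S, (α i + r i * u) := by
        rw [Finset.add_sum_erase _ (fun i => α i + r i * u) (Finset.mem_univ j),
          Finset.sum_add_distrib, Finset.sum_mul]
      rw [Pi.mul_apply, ← ENNReal.ofReal_mul (mul_pos (hr j) (Real.exp_pos _)).le,
        ← ENNReal.ofReal_mul (div_pos (hr j) hrs).le, h3, neg_add (α j + r j * u), Real.exp_add]
      congr 1
      field_simp
    rw [lintegral_congr h2, lintegral_const_mul _ (by fun_prop), lintegral_Ioc_exp _ hrs hst,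
      ← ENNReal.ofReal_mul (div_pos (hr j) hrs).le]
    simp only [Finset.sum_add_distrib, Finset.sum_mul]
  rw [measureReal_def, hmain, ENNReal.toReal_ofReal]
  refine mul_nonneg (div_pos (hr j) hrs).le (sub_nonneg.2 ?_)
  gcongr with i
  exact (hr i).le

/-! ### Cell probabilities of a unit -/

lemma cumHazard_affine (D : Plan L) (a : Param R) (i : Fin 2) (t : ℝ) (j : Fin R) :
    cumHazard D a i t j = cumHazard D a i 0 j + rate a (D.stress i) j * t := by
  fin_cases i <;> simp [cumHazard] <;> ring

lemma causeCDF_eq (D : Plan L) (a : Param R) (j : Fin R) {i : Fin 2} {t : ℝ}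
    (h0 : i = 0 → 0 ≤ t ∧ t ≤ D.tau1) (h1 : i = 1 → D.tau1 ≤ t) :
    causeCDF D a j t = 1 - Real.exp (-cumHazard D a i t j) := by
  have hτ := D.tau1_pos
  simp only [causeCDF, add_shift_div_scale]
  fin_cases i
  · obtain ⟨ht0, ht1⟩ := h0 rfl
    rcases ht0.eq_or_lt with rfl | ht0
    · simp [cumHazard]
    · rw [if_neg (not_le.2 ht0)]
      rcases ht1.eq_or_lt with rfl | ht1
      · simp [cumHazard_tau1 D a 1 0]
      · simp [ht1]
  · have ht := h1 rfl
    rw [if_neg (not_le.2 (hτ.trans_le ht)), if_neg (not_lt.2 ht)]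
    rfl

/-- No mass lies on `(-∞, 0]`, and on either side of the stress change the law has a local density.
Hence there are no atoms and ties between causes are negligible. -/
lemma nullSingletonClass_map {X : Fin R → Ω → ℝ} (hX : ∀ j, Measurable (X j)) {D : Plan L}
    {a : Param R} (hlaw : ∀ j t, μ.real {ω | X j ω ≤ t} = causeCDF D a j t)
    (j : Fin R) : NullSingletonClass (μ.map (X j)) := by
  have hp : IsProbabilityMeasure (μ.map (X j)) :=
    Measure.isProbabilityMeasure_map (hX j).aemeasurable
  have hν : ∀ u, (μ.map (X j)).real (Iic u) = causeCDF D a j u := by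
    intro u
    rw [map_measureReal_apply (hX j) measurableSet_Iic, ← hlaw j u]
    rfl
  refine ⟨fun u => ?_⟩
  rcases le_or_gt u 0 with hu | hu
  · have h1 : (μ.map (X j)).real (Iic u) = 0 := by rw [hν, causeCDF, if_pos hu]
    rw [measureReal_eq_zero_iff] at h1
    exact measure_mono_null (Set.singleton_subset_iff.2 (Set.mem_Iic.2 le_rfl)) h1
  · rcases le_or_gt u D.tau1 with hu1 | hu1
    · refine measure_singleton_eq_zero (rate_pos a (D.stress 0) j) (s := 0) (t := D.tau1)
        (α := cumHazard D a 0 0 j) (fun v hv => ?_) ⟨hu, hu1⟩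
      rw [hν, ← cumHazard_affine, causeCDF_eq D a j (i := 0) (fun _ => hv) (by simp)]
    · refine measure_singleton_eq_zero (rate_pos a (D.stress 1) j) (s := D.tau1) (t := u)
        (α := cumHazard D a 1 0 j) (fun v hv => ?_) ⟨hu1, le_rfl⟩
      rw [hν, ← cumHazard_affine, causeCDF_eq D a j (i := 1) (by simp) (fun _ => hv.1)]

/-- By Fubini the diagonal is null, because its sections are single points. -/
lemma ae_ne {X : Fin R → Ω → ℝ} (hX : ∀ j, Measurable (X j)) {D : Plan L}
    {a : Param R} (hlaw : ∀ j t, μ.real {ω | X j ω ≤ t} = causeCDF D a j t)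
    (hind : iIndepFun X μ) {i j : Fin R} (hij : i ≠ j) : ∀ᵐ ω ∂μ, X i ω ≠ X j ω := by
  have := nullSingletonClass_map hX hlaw j
  have hp : ∀ j, IsProbabilityMeasure (μ.map (X j)) := fun j =>
    Measure.isProbabilityMeasure_map (hX j).aemeasurable
  have hp1 := hp i
  have hp2 := hp j
  have hmap := (indepFun_iff_map_prod_eq_prod_map_map (hX i).aemeasurable
    (hX j).aemeasurable).1 (hind.indepFun hij)
  have hm : MeasurableSet {z : ℝ × ℝ | z.1 = z.2} :=
    measurableSet_eq_fun measurable_fst measurable_snd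
  have h0 : μ.map (fun ω => (X i ω, X j ω)) {z : ℝ × ℝ | z.1 = z.2} = 0 := by
    rw [hmap, Measure.measure_prod_null hm]
    refine Eventually.of_forall fun x => ?_
    have : Prod.mk x ⁻¹' {z : ℝ × ℝ | z.1 = z.2} = {x} := by
      ext y; simp [eq_comm]
    change μ.map (X j) (Prod.mk x ⁻¹' _) = 0
    rw [this]
    exact measure_singleton x
  rw [Measure.map_apply ((hX i).prodMk (hX j)) hm] at h0
  rw [ae_iff]
  simpa using h0

/-- The stress does not change inside an inspection interval, so the hazards are affine there and
`measureReal_competing` applies. Survival is a product by independence. -/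
lemma measureReal_fallsIn {X : Fin R → Ω → ℝ} (hX : ∀ j, Measurable (X j)) {D : Plan L}
    {a : Param R} (hlaw : ∀ j t, μ.real {ω | X j ω ≤ t} = causeCDF D a j t)
    (hind : iIndepFun X μ) (c : Cell L R) :
    μ.real {ω | D.FallsIn (fun j => X j ω) c} = cellProb D a c := by
  rcases c with _ | ⟨l, j⟩
  · have hset : {ω | D.FallsIn (fun j => X j ω) (none : Cell L R)} = ⋂ j, X j ⁻¹' Ioi D.tau2 := by
      ext ω
      simp [Plan.FallsIn]
    rw [hset, measureReal_def, hind.meas_iInter fun i => ⟨_, measurableSet_Ioi, rfl⟩,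
      ENNReal.toReal_prod]
    change _ = surv D a 1 D.tau2
    rw [surv_eq, ← Finset.sum_neg_distrib, Real.exp_sum]
    refine Finset.prod_congr rfl fun j _ => ?_
    have h1 : X j ⁻¹' Ioi D.tau2 = {ω | X j ω ≤ D.tau2}ᶜ := by
      ext ω; simp
    change μ.real _ = _
    rw [h1, probReal_compl_eq_one_sub (measurableSet_le (hX j) measurable_const), hlaw,
      causeCDF_eq D a j (i := 1) (by simp) (fun _ => D.tau1_lt_tau2.le)]
    ring
  · have hm := D.inspect_strictMono.monotone
    have h0 := D.stage_eq_zero_iff l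
    have h1 := D.stage_eq_one_iff l
    have h := measureReal_competing hX hind (hm l.castSucc_lt_succ.le)
      (α := cumHazard D a (D.stage l) 0) (r := rate a (D.stress (D.stage l)))
      (fun j => rate_pos a _ j) (fun j u hu => by
        rw [hlaw, ← cumHazard_affine]
        refine causeCDF_eq D a j (fun h => ⟨?_, hu.2.trans (hm (h0.1 h))⟩)
          (fun h => (hm (h1.1 h)).trans hu.1)
        rw [← D.inspect_zero]
        exact (hm (Fin.zero_le _)).trans hu.1) j
    simp only [← cumHazard_affine, ← surv_eq] at h
    exact h

lemma Plan.FallsIn.unique {D : Plan L} {t : Fin R → ℝ} (ht : ∀ i j, i ≠ j → t i ≠ t j)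
    {c c' : Cell L R} (h : D.FallsIn t c) (h' : D.FallsIn t c') : c = c' := by
  have hle : ∀ l : Fin L, D.inspect l.succ ≤ D.tau2 := fun l =>
    D.inspect_strictMono.monotone (Fin.le_last _)
  rcases c with _ | ⟨l, j⟩ <;> rcases c' with _ | ⟨l', j'⟩
  · rfl
  · exact absurd (h j') (not_lt.2 (h'.2.1.trans (hle l')))
  · exact absurd (h' j) (not_lt.2 (h.2.1.trans (hle l)))
  · have hj : j = j' := by
      by_contra hne
      exact ht j j' hne (le_antisymm (h.2.2 j') (h'.2.2 j))
    subst hj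
    have h1 := D.inspect_strictMono.lt_iff_lt.1 (h.1.trans_le h'.2.1)
    have h2 := D.inspect_strictMono.lt_iff_lt.1 (h'.1.trans_le h.2.1)
    simp only [Fin.lt_def, Fin.val_castSucc, Fin.val_succ] at h1 h2
    have : l = l' := Fin.ext (by omega)
    rw [this]

lemma Plan.measurableSet_fallsIn (D : Plan L) (c : Cell L R) :
    MeasurableSet {t : Fin R → ℝ | D.FallsIn t c} := by
  rcases c with _ | ⟨l, j⟩
  · simp only [Plan.FallsIn, Set.ofPred_forall]
    exact MeasurableSet.iInter fun j => measurableSet_lt measurable_const (measurable_pi_apply j)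
  · simp only [Plan.FallsIn, Set.ofPred_and, Set.ofPred_forall]
    exact (measurableSet_lt measurable_const (measurable_pi_apply j)).inter
      ((measurableSet_le (measurable_pi_apply j) measurable_const).inter
        (MeasurableSet.iInter fun j' =>
          measurableSet_le (measurable_pi_apply j) (measurable_pi_apply j')))

end Units

/-! ### Limit theory of the cell frequencies and transfer to the estimator. -/

section Asymptotics

variable {L R : ℕ} {Ω : Type*} [MeasurableSpace Ω] {μ : Measure Ω} [IsProbabilityMeasure μ]

/-! ### The empirical cell frequencies -/

/-- Indicator of the cell `c`, as a function of the latent lifetimes. -/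
def cellInd (D : Plan L) (c : Cell L R) : (Fin R → ℝ) → ℝ :=
  Set.indicator {t | D.FallsIn t c} 1

lemma measurable_cellInd (D : Plan L) (c : Cell L R) : Measurable (cellInd D c) :=
  measurable_one.indicator (D.measurableSet_fallsIn c)

lemma cellInd_of_fallsIn {D : Plan L} {c : Cell L R} {t : Fin R → ℝ} (h : D.FallsIn t c) :
    cellInd D c t = 1 := Set.indicator_of_mem (s := {t | D.FallsIn t c}) h 1

lemma cellInd_of_not_fallsIn {D : Plan L} {c : Cell L R} {t : Fin R → ℝ} (h : ¬ D.FallsIn t c) :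
    cellInd D c t = 0 := Set.indicator_of_notMem (s := {t | D.FallsIn t c}) h 1

lemma empirical_eq {Ω : Type*} (D : Plan L) (T : ℕ → Fin R → Ω → ℝ) (N : ℕ) (ω : Ω) (c : Cell L R) :
    empirical D T N ω c = (∑ k ∈ Finset.range N, cellInd D c fun j => T k j ω) / N := by
  classical
  rw [empirical, Finset.natCast_card_filter]
  rfl

lemma integral_cellInd {X : Fin R → Ω → ℝ} (hX : ∀ j, Measurable (X j)) {D : Plan L}
    {a : Param R} (hlaw : ∀ j t, μ.real {ω | X j ω ≤ t} = causeCDF D a j t)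
    (hind : iIndepFun X μ) (c : Cell L R) :
    ∫ ω, cellInd D c (fun j => X j ω) ∂μ = cellProb D a c := by
  have hm : Measurable fun ω j => X j ω := measurable_pi_lambda _ hX
  have h : (fun ω => cellInd D c fun j => X j ω) =
      Set.indicator ((fun ω j => X j ω) ⁻¹' {t | D.FallsIn t c}) 1 := rfl
  rw [h, integral_indicator_one (hm (D.measurableSet_fallsIn c)),
    ← measureReal_fallsIn hX hlaw hind c]
  rfl

lemma abs_cellInd_le (D : Plan L) (c : Cell L R) (t : Fin R → ℝ) : |cellInd D c t| ≤ 1 := by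
  by_cases h : D.FallsIn t c
  · simp [cellInd_of_fallsIn h]
  · simp [cellInd_of_not_fallsIn h]

lemma integrable_cellInd {X : Fin R → Ω → ℝ} (hX : ∀ j, Measurable (X j)) (D : Plan L)
    (c : Cell L R) : Integrable (fun ω => cellInd D c fun j => X j ω) μ :=
  Integrable.of_bound
    ((measurable_cellInd D c).comp (measurable_pi_lambda _ hX)).aestronglyMeasurable 1
    (Eventually.of_forall fun _ => abs_cellInd_le D c _)

/-- Almost surely, a unit is recorded in exactly one cell. -/
lemma ae_exists_cell (hR : 1 ≤ R) {X : Fin R → Ω → ℝ} (hX : ∀ j, Measurable (X j)) {D : Plan L}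
    {a : Param R} (hlaw : ∀ j t, μ.real {ω | X j ω ≤ t} = causeCDF D a j t)
    (hind : iIndepFun X μ) :
    ∀ᵐ ω ∂μ, ∃ c₀ : Cell L R, ∀ c, cellInd D c (fun j => X j ω) = if c = c₀ then 1 else 0 := by
  have hne : ∀ᵐ ω ∂μ, ∀ i j, i ≠ j → X i ω ≠ X j ω :=
    ae_all_iff.2 fun i => ae_all_iff.2 fun j => ae_all_iff.2 fun hij => ae_ne hX hlaw hind hij
  have hone : ∀ᵐ ω ∂μ, ∀ c₀ : Cell L R, D.FallsIn (fun j => X j ω) c₀ →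
      ∀ c, cellInd D c (fun j => X j ω) = if c = c₀ then 1 else 0 := by
    filter_upwards [hne] with ω hω c₀ h₀ c
    split_ifs with h
    · exact h ▸ cellInd_of_fallsIn h₀
    · exact cellInd_of_not_fallsIn fun hc => h (hc.unique hω h₀)
  have hnn : 0 ≤ᵐ[μ] fun ω => 1 - ∑ c : Cell L R, cellInd D c (fun j => X j ω) := by
    filter_upwards [hone] with ω hω
    by_cases h : ∃ c₀ : Cell L R, D.FallsIn (fun j => X j ω) c₀
    · obtain ⟨c₀, h₀⟩ := h
      simp [hω c₀ h₀]
    · push Not at h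
      simp [cellInd_of_not_fallsIn (h _)]
  have hint : Integrable (fun ω => ∑ c : Cell L R, cellInd D c (fun j => X j ω)) μ :=
    integrable_finsetSum _ fun c _ => integrable_cellInd hX D c
  -- The cells are almost surely disjoint, so one minus the sum of the indicators is nonnegative.
  -- Its integral is zero because the cell probabilities sum to one, so almost every unit falls in
  -- some cell without an argument by cases on its lifetimes.
  have hzero : ∫ ω, (1 - ∑ c : Cell L R, cellInd D c (fun j => X j ω)) ∂μ = 0 := by
    rw [integral_sub (integrable_const _) hint,
      integral_finsetSum _ fun c _ => integrable_cellInd hX D c]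
    simp [integral_cellInd hX hlaw hind, sum_cellProb hR]
  have h0 := (integral_eq_zero_iff_of_nonneg_ae hnn ((integrable_const _).sub hint)).1 hzero
  filter_upwards [h0, hone] with ω h1 h2
  by_contra! hcon
  have : ∀ c, ¬ D.FallsIn (fun j => X j ω) c := fun c hc => by
    obtain ⟨c', hc'⟩ := hcon c
    exact hc' (h2 c hc c')
  simp [cellInd_of_not_fallsIn (this _)] at h1

/-- Linear score of a unit: the weight of the cell in which it is recorded. -/
def score (D : Plan L) (v : Cell L R → ℝ) (t : Fin R → ℝ) : ℝ := ∑ c, v c * cellInd D c t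

lemma measurable_score (D : Plan L) (v : Cell L R → ℝ) : Measurable (score D v) :=
  Finset.measurable_fun_sum _ fun c _ => (measurable_cellInd D c).const_mul (v c)

lemma memLp_score {X : Fin R → Ω → ℝ} (hX : ∀ j, Measurable (X j)) (D : Plan L)
    (v : Cell L R → ℝ) : MemLp (fun ω => score D v fun j => X j ω) 2 μ := by
  refine MemLp.of_bound
    ((measurable_score D v).comp (measurable_pi_lambda _ hX)).aestronglyMeasurable (∑ c, |v c|)
    (Eventually.of_forall fun ω => ?_)
  refine (norm_sum_le _ _).trans (Finset.sum_le_sum fun c _ => ?_)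
  rw [norm_mul]
  exact mul_le_of_le_one_right (abs_nonneg _) (abs_cellInd_le D c _)

lemma integral_score {X : Fin R → Ω → ℝ} (hX : ∀ j, Measurable (X j)) {D : Plan L}
    {a : Param R} (hlaw : ∀ j t, μ.real {ω | X j ω ≤ t} = causeCDF D a j t)
    (hind : iIndepFun X μ) (v : Cell L R → ℝ) :
    ∫ ω, score D v (fun j => X j ω) ∂μ = v ⬝ᵥ cellProb D a := by
  simp only [score]
  rw [integral_finsetSum _ fun c _ => (integrable_cellInd hX D c).const_mul _]
  simp only [integral_const_mul, integral_cellInd hX hlaw hind]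
  rfl

/-- Exactly one indicator is nonzero almost surely, so the square of a score is the score of the
squared weights. -/
lemma variance_score (hR : 1 ≤ R) {X : Fin R → Ω → ℝ} (hX : ∀ j, Measurable (X j)) {D : Plan L}
    {a : Param R} (hlaw : ∀ j t, μ.real {ω | X j ω ≤ t} = causeCDF D a j t)
    (hind : iIndepFun X μ) (v : Cell L R → ℝ) :
    Var[fun ω => score D v fun j => X j ω; μ] =
      ∑ c, v c ^ 2 * cellProb D a c - (v ⬝ᵥ cellProb D a) ^ 2 := by
  rw [variance_eq_sub (memLp_score hX D v), integral_score hX hlaw hind]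
  congr 1
  have h : (fun ω => score D v fun j => X j ω) ^ 2 =ᵐ[μ]
      fun ω => score D (fun c => v c ^ 2) fun j => X j ω := by
    filter_upwards [ae_exists_cell hR hX hlaw hind] with ω ⟨c₀, h₀⟩
    simp only [score, h₀, mul_ite, mul_one, mul_zero, Finset.sum_ite_eq', Finset.mem_univ, if_true,
      Pi.pow_apply]
  rw [integral_congr_ae h, integral_score hX hlaw hind]
  rfl

/-- The joint law of the double array is a product over pairs; currying regroups it as a product
over units of the laws of their lifetime vectors. -/
lemma iIndepFun_units {T : ℕ → Fin R → Ω → ℝ} (hTmeas : ∀ k j, Measurable (T k j))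
    (hTindep : iIndepFun (fun (kj : ℕ × Fin R) => T kj.1 kj.2) μ) :
    iIndepFun (fun k ω j => T k j ω) μ := by
  have hprob : ∀ k j, IsProbabilityMeasure (μ.map (T k j)) := fun k j =>
    Measure.isProbabilityMeasure_map (hTmeas k j).aemeasurable
  have hm : Measurable fun ω (kj : ℕ × Fin R) => T kj.1 kj.2 ω :=
    measurable_pi_lambda _ fun kj => hTmeas kj.1 kj.2
  have h1 := hTindep.map_fun_eq_infinitePi_map
    fun kj : ℕ × Fin R => hTmeas kj.1 kj.2
  rw [iIndepFun_iff_map_fun_eq_infinitePi_map fun k => measurable_pi_lambda _ (hTmeas k)]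
  have h2 : μ.map (fun ω k j => T k j ω) =
      (μ.map fun ω (kj : ℕ × Fin R) => T kj.1 kj.2 ω).map (MeasurableEquiv.curry ℕ (Fin R) ℝ) := by
    rw [Measure.map_map (by fun_prop) hm]
    rfl
  rw [h2, h1, Measure.infinitePi_map_curry fun k j => μ.map (T k j)]
  congr 1
  funext k
  exact ((hTindep.precomp (g := fun j => (k, j))
    (Prod.mk_right_injective k)).map_fun_eq_infinitePi_map (hTmeas k)).symm

section Sample

variable {T : ℕ → Fin R → Ω → ℝ} {D : Plan L} {a₀ : Param R}

lemma iIndepFun_unit {μ : Measure Ω} (hTindep : iIndepFun (fun (kj : ℕ × Fin R) => T kj.1 kj.2) μ) (k : ℕ) :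
    iIndepFun (T k) μ :=
  hTindep.precomp (g := fun j => (k, j)) (Prod.mk_right_injective k)

/-- By independence the law of a unit is the product of its marginals, and these are determined by
their distribution functions. -/
lemma identDistrib_units (hTmeas : ∀ k j, Measurable (T k j))
    (hTindep : iIndepFun (fun (kj : ℕ × Fin R) => T kj.1 kj.2) μ)
    (hTlaw : ∀ k j t, μ.real {ω | T k j ω ≤ t} = causeCDF D a₀ j t) (k : ℕ) :
    IdentDistrib (fun ω j => T k j ω) (fun ω j => T 0 j ω) μ μ where
  aemeasurable_fst := (measurable_pi_lambda _ (hTmeas k)).aemeasurable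
  aemeasurable_snd := (measurable_pi_lambda _ (hTmeas 0)).aemeasurable
  map_eq := by
    rw [(iIndepFun_unit hTindep k).map_fun_eq_pi_map fun j => (hTmeas k j).aemeasurable,
      (iIndepFun_unit hTindep 0).map_fun_eq_pi_map fun j => (hTmeas 0 j).aemeasurable]
    congr 1
    funext j
    refine Measure.ext_of_Iic _ _ fun t => ?_
    rw [Measure.map_apply (hTmeas k j) measurableSet_Iic,
      Measure.map_apply (hTmeas 0 j) measurableSet_Iic,
      ← ENNReal.toReal_eq_toReal_iff' (measure_ne_top _ _) (measure_ne_top _ _)]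
    exact (hTlaw k j t).trans (hTlaw 0 j t).symm

lemma dotProduct_empirical {Ω : Type*} (D : Plan L) (T : ℕ → Fin R → Ω → ℝ) (N : ℕ) (ω : Ω)
    (v : Cell L R → ℝ) :
    v ⬝ᵥ empirical D T N ω = (∑ k ∈ Finset.range N, score D v fun j => T k j ω) / N := by
  simp only [dotProduct, empirical_eq, score]
  rw [Finset.sum_comm, Finset.sum_div]
  exact Finset.sum_congr rfl fun c _ => by rw [← Finset.mul_sum, mul_div_assoc]

/-- A scalar limit theorem for a fixed `v` suffices, since the expansion reduces each characteristic
to one linear functional of the frequencies. -/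
lemma tendstoInDistribution_empirical (hTmeas : ∀ k j, Measurable (T k j))
    (hTindep : iIndepFun (fun (kj : ℕ × Fin R) => T kj.1 kj.2) μ)
    (hTlaw : ∀ k j t, μ.real {ω | T k j ω ≤ t} = causeCDF D a₀ j t) (v : Cell L R → ℝ) :
    TendstoInDistribution
      (fun (N : ℕ) ω => √(N : ℝ) * (v ⬝ᵥ (empirical D T N ω - cellProb D a₀))) atTop
      (id : ℝ → ℝ) (fun _ => μ)
      (gaussianReal 0 Var[fun ω => score D v fun j => T 0 j ω; μ].toNNReal) := by
  have h := tendstoInDistribution_inv_sqrt_mul_sum_sub (P := μ)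
    (X := fun k ω => score D v fun j => T k j ω)
    (HasLaw.id (μ := gaussianReal 0 Var[fun ω => score D v fun j => T 0 j ω; μ].toNNReal))
    (memLp_score (hTmeas 0) D v)
    ((iIndepFun_units hTmeas hTindep).comp (fun _ => score D v) fun _ => measurable_score D v)
    (fun k => (identDistrib_units hTmeas hTindep hTlaw k).comp (measurable_score D v))
  convert! h using 3 with N ω
  rw [integral_score (hTmeas 0) (hTlaw 0) (iIndepFun_unit hTindep 0), dotProduct_sub,
    dotProduct_empirical]
  rcases eq_or_ne N 0 with rfl | hN
  · simp
  · have h1 : (0 : ℝ) < N := by positivity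
    have h2 : √(N : ℝ) ≠ 0 := by positivity
    have h3 := Real.mul_self_sqrt h1.le
    rw [eq_inv_mul_iff_mul_eq₀ h2, ← mul_assoc, h3]
    field_simp

/-- Chebyshev's inequality, with the crude bound one for the variance of a cell indicator. It yields
both consistency of the frequencies and their boundedness at scale `1 / √N`. -/
lemma measureReal_abs_empirical_sub_ge (hR : 1 ≤ R) (hTmeas : ∀ k j, Measurable (T k j))
    (hTindep : iIndepFun (fun (kj : ℕ × Fin R) => T kj.1 kj.2) μ)
    (hTlaw : ∀ k j t, μ.real {ω | T k j ω ≤ t} = causeCDF D a₀ j t) {N : ℕ} (hN : 0 < N) {η : ℝ}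
    (hη : 0 < η) (c : Cell L R) :
    μ.real {ω | η ≤ |empirical D T N ω c - cellProb D a₀ c|} ≤ 1 / (N * η ^ 2) := by
  classical
  set v : Cell L R → ℝ := Pi.single c 1 with hv
  let X : ℕ → Ω → ℝ := fun k ω => score D v fun j => T k j ω
  have hN' : (0 : ℝ) < N := by positivity
  have hXmem : ∀ k, MemLp (X k) 2 μ := fun k => memLp_score (hTmeas k) D v
  have hXint : ∀ k, ∫ ω, X k ω ∂μ = cellProb D a₀ c := by
    intro k
    rw [integral_score (hTmeas k) (hTlaw k) (iIndepFun_unit hTindep k)]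
    simp [hv]
  have hXind : iIndepFun X μ :=
    (iIndepFun_units hTmeas hTindep).comp (fun _ => score D v) fun _ => measurable_score D v
  have hp1 : cellProb D a₀ c ≤ 1 := by
    rw [← sum_cellProb hR D a₀]
    exact Finset.single_le_sum (fun c _ => (cellProb_pos hR D a₀ c).le) (Finset.mem_univ c)
  have hvar : ∀ k, Var[X k; μ] ≤ 1 := by
    intro k
    rw [variance_score hR (hTmeas k) (hTlaw k) (iIndepFun_unit hTindep k)]
    have : ∑ c', v c' ^ 2 * cellProb D a₀ c' = cellProb D a₀ c := by
      rw [Finset.sum_eq_single c (fun c' _ h => by simp [hv, h]) (by simp)]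
      simp [hv]
    rw [this]
    nlinarith [sq_nonneg (v ⬝ᵥ cellProb D a₀)]
  have hsum : Var[∑ k ∈ Finset.range N, X k; μ] ≤ N := by
    rw [IndepFun.variance_sum (fun k _ => hXmem k) fun i _ j _ hij => hXind.indepFun hij]
    refine (Finset.sum_le_sum fun k _ => hvar k).trans ?_
    simp
  have hsmem : MemLp (∑ k ∈ Finset.range N, X k) 2 μ := memLp_finsetSum' _ fun k _ => hXmem k
  have hsint : ∫ ω, (∑ k ∈ Finset.range N, X k) ω ∂μ = N * cellProb D a₀ c := by
    simp only [Finset.sum_apply]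
    rw [integral_finsetSum _ fun k _ => (hXmem k).integrable (by norm_num)]
    simp [hXint]
  have hcheb := meas_ge_le_variance_div_sq hsmem (c := N * η) (by positivity)
  rw [hsint] at hcheb
  have hset : {ω | η ≤ |empirical D T N ω c - cellProb D a₀ c|} =
      {ω | N * η ≤ |(∑ k ∈ Finset.range N, X k) ω - N * cellProb D a₀ c|} := by
    ext ω
    have h1 : empirical D T N ω c = (∑ k ∈ Finset.range N, X k) ω / N := by
      have := dotProduct_empirical D T N ω v
      simpa [hv, X] using this
    have h2 : (∑ k ∈ Finset.range N, X k) ω - N * cellProb D a₀ c =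
        N * (empirical D T N ω c - cellProb D a₀ c) := by
      rw [h1]; field_simp
    simp only [Set.mem_ofPred_eq, h2, abs_mul, abs_of_pos hN', mul_le_mul_iff_right₀ hN']
  rw [hset, measureReal_def]
  refine (ENNReal.toReal_mono ENNReal.ofReal_ne_top hcheb).trans ?_
  rw [ENNReal.toReal_ofReal (by have := variance_nonneg (∑ k ∈ Finset.range N, X k) μ; positivity)]
  calc Var[∑ k ∈ Finset.range N, X k; μ] / (N * η) ^ 2 ≤ N / (N * η) ^ 2 := by gcongr
    _ = 1 / (N * η ^ 2) := by field_simp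

lemma measureReal_norm_empirical_sub_ge (hR : 1 ≤ R) (hTmeas : ∀ k j, Measurable (T k j))
    (hTindep : iIndepFun (fun (kj : ℕ × Fin R) => T kj.1 kj.2) μ)
    (hTlaw : ∀ k j t, μ.real {ω | T k j ω ≤ t} = causeCDF D a₀ j t) {N : ℕ} (hN : 0 < N) {η : ℝ}
    (hη : 0 < η) :
    μ.real {ω | η ≤ ‖empirical D T N ω - cellProb D a₀‖} ≤
      Fintype.card (Cell L R) / (N * η ^ 2) := by
  have hsub : {ω | η ≤ ‖empirical D T N ω - cellProb D a₀‖} ⊆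
      ⋃ c : Cell L R, {ω | η ≤ |empirical D T N ω c - cellProb D a₀ c|} := by
    intro ω hω
    by_contra hcon
    simp only [Set.mem_iUnion, Set.mem_ofPred_eq, not_exists, not_le] at hcon
    exact absurd ((pi_norm_lt_iff hη).2 fun c => hcon c) (not_lt.2 hω)
  refine (measureReal_mono hsub).trans ((measureReal_iUnion_fintype_le _).trans ?_)
  refine (Finset.sum_le_sum fun c _ =>
    measureReal_abs_empirical_sub_ge hR hTmeas hTindep hTlaw hN hη c).trans ?_
  simp [div_eq_mul_inv]

lemma ae_empirical_mem_stdSimplex (hR : 1 ≤ R) (hTmeas : ∀ k j, Measurable (T k j))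
    (hTindep : iIndepFun (fun (kj : ℕ × Fin R) => T kj.1 kj.2) μ)
    (hTlaw : ∀ k j t, μ.real {ω | T k j ω ≤ t} = causeCDF D a₀ j t) {N : ℕ} (hN : 0 < N) :
    ∀ᵐ ω ∂μ, empirical D T N ω ∈ stdSimplex ℝ (Cell L R) := by
  have h : ∀ᵐ ω ∂μ, ∀ k, ∃ c₀ : Cell L R, ∀ c, cellInd D c (fun j => T k j ω) =
      if c = c₀ then 1 else 0 :=
    ae_all_iff.2 fun k => ae_exists_cell hR (hTmeas k) (hTlaw k) (iIndepFun_unit hTindep k)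
  filter_upwards [h] with ω hω
  refine ⟨fun c => by unfold empirical; positivity, ?_⟩
  simp only [empirical_eq, ← Finset.sum_div]
  rw [Finset.sum_comm]
  have h1 : ∀ k, ∑ c : Cell L R, cellInd D c (fun j => T k j ω) = 1 := by
    intro k
    obtain ⟨c₀, h₀⟩ := hω k
    simp [h₀]
  simp only [h1]
  have : (N : ℝ) ≠ 0 := by positivity
  simp [this]

/-- Outside two rare events the frequencies are within `δ` of the truth, where the expansion holds
and `hest` makes the estimate a minimiser, and √N times their deviation is below `η / ε`, so the
scaled error is below `η`. -/
lemma tendstoInMeasure_remainder (hR : 1 ≤ R) {β : ℝ} (hβ : 0 ≤ β)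
    (hTmeas : ∀ k j, Measurable (T k j))
    (hTindep : iIndepFun (fun (kj : ℕ × Fin R) => T kj.1 kj.2) μ)
    (hTlaw : ∀ k j t, μ.real {ω | T k j ω ≤ t} = causeCDF D a₀ j t)
    {est : ℕ → Ω → Param R}
    (hest : ∀ N, ∀ᵐ ω ∂μ, AllObserved D (empirical D T N ω) →
      (∃ a, IsMDPDE D β (empirical D T N ω) a) → IsMDPDE D β (empirical D T N ω) (est N ω))
    {g : Param R → ℝ} {u : Fin R × Fin 2 → ℝ} (hg : HasPartials g u a₀) :
    TendstoInMeasure μ ((fun (N : ℕ) ω => √(N : ℝ) * (g (est N ω) - g a₀)) - fun (N : ℕ) ω =>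
      √(N : ℝ) * (influence D β a₀ u ⬝ᵥ (empirical D T N ω - cellProb D a₀))) atTop 0 := by
  rw [tendstoInMeasure_iff_measureReal_norm]
  intro η hη
  set C : ℝ := ((Fintype.card (Cell L R) : ℕ) : ℝ) with hC
  have hCpos : 0 < C := by rw [hC]; exact_mod_cast Fintype.card_pos
  rw [Metric.tendsto_atTop]
  intro κ hκ
  -- With this `ε` the Chebyshev bound of the event `B` equals C ε² / η² = κ / 4, free of N. The
  -- event `A` has probability below κ / 2 once N exceeds 2C / (κ δ²).
  set ε := η * √(κ / (4 * C)) with hε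
  have hεpos : 0 < ε := by positivity
  obtain ⟨δ, hδ, hexp⟩ := mdpde_expansion hR D a₀ hβ hg hεpos
  obtain ⟨N₀, hN₀⟩ := exists_nat_gt (2 * C / (κ * δ ^ 2))
  refine ⟨N₀ + 1, fun N hN => ?_⟩
  have hNpos : 0 < N := by omega
  have hN' : (0 : ℝ) < N := by positivity
  have hsN : 0 < √(N : ℝ) := by positivity
  have hsq := Real.sq_sqrt hN'.le
  rw [Real.dist_eq, sub_zero, abs_of_nonneg measureReal_nonneg]
  set A := {ω | δ ≤ ‖empirical D T N ω - cellProb D a₀‖}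
  set B := {ω | η / (ε * √(N : ℝ)) ≤ ‖empirical D T N ω - cellProb D a₀‖}
  have hA : μ.real A < κ / 2 := by
    refine (measureReal_norm_empirical_sub_ge hR hTmeas hTindep hTlaw hNpos hδ).trans_lt ?_
    have h1 : 2 * C / (κ * δ ^ 2) < N := hN₀.trans_le (by exact_mod_cast (by omega : N₀ ≤ N))
    rw [div_lt_iff₀ (by positivity)] at h1 ⊢
    linarith
  have hB : μ.real B ≤ κ / 4 := by
    refine (measureReal_norm_empirical_sub_ge hR hTmeas hTindep hTlaw hNpos
      (by positivity)).trans_eq ?_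
    have h1 : ε ^ 2 = η ^ 2 * (κ / (4 * C)) := by
      rw [hε, mul_pow, Real.sq_sqrt (by positivity)]
    rw [div_pow, mul_pow, h1, hsq, ← hC]
    field_simp
  have hle : μ.real {ω | η ≤ ‖((fun (N : ℕ) ω => √(N : ℝ) * (g (est N ω) - g a₀)) -
      fun (N : ℕ) ω => √(N : ℝ) * (influence D β a₀ u ⬝ᵥ
        (empirical D T N ω - cellProb D a₀))) N ω - (0 : Ω → ℝ) ω‖} ≤ μ.real (A ∪ B) := by
    refine ENNReal.toReal_mono (measure_ne_top _ _) (measure_mono_ae ?_)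
    filter_upwards [ae_empirical_mem_stdSimplex hR hTmeas hTindep hTlaw hNpos, hest N]
      with ω h1 h2 h3
    by_contra hcon
    obtain ⟨hnA, hnB⟩ := not_or.1 hcon
    have hnA : ‖empirical D T N ω - cellProb D a₀‖ < δ := not_le.1 hnA
    have hnB : ‖empirical D T N ω - cellProb D a₀‖ < η / (ε * √(N : ℝ)) := not_le.1 hnB
    obtain ⟨hobs, hex, hbound⟩ := hexp _ h1 (by rwa [dist_eq_norm])
    have hb := hbound _ (h2 hobs hex)
    have h3 : η ≤ ‖√(N : ℝ) * (g (est N ω) - g a₀) - √(N : ℝ) * (influence D β a₀ u ⬝ᵥ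
        (empirical D T N ω - cellProb D a₀)) - 0‖ := h3
    rw [sub_zero, ← mul_sub, norm_mul, Real.norm_eq_abs, Real.norm_eq_abs, abs_of_pos hsN] at h3
    rw [lt_div_iff₀ (by positivity)] at hnB
    have := mul_le_mul_of_nonneg_left hb hsN.le
    linarith
  have := measureReal_union_le A B (μ := μ)
  linarith

/-! ### Asymptotic normality -/

lemma matJ_transpose (D : Plan L) (β : ℝ) (a : Param R) : (matJ D β a)ᵀ = matJ D β a := by
  simp [matJ, Matrix.transpose_mul, Matrix.mul_assoc]

/-- The variance of the influence of a single unit. -/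
lemma variance_influence (hR : 1 ≤ R) (D : Plan L) (β : ℝ) (a : Param R)
    (u : Fin R × Fin 2 → ℝ) :
    ∑ c, influence D β a u c ^ 2 * cellProb D a c - (influence D β a u ⬝ᵥ cellProb D a) ^ 2 =
      u ⬝ᵥ (matSigma D β a *ᵥ u) := by
  set w := (matJ D β a)⁻¹ *ᵥ u with hw
  have hJt : (matJ D β a)⁻¹ᵀ = (matJ D β a)⁻¹ := by
    rw [Matrix.transpose_nonsing_inv, matJ_transpose]
  set y := matW D a *ᵥ w with hy
  have hinf : ∀ c, influence D β a u c = cellProb D a c ^ (β - 1) * y c := by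
    intro c
    rw [influence, hJt]
  -- Symmetry of J lets both outer inverses act on `u`, and both factors W then produce the same
  -- vector `y`.
  have h1 : u ⬝ᵥ (matSigma D β a *ᵥ u) = y ⬝ᵥ ((Matrix.diagonal
      (fun c => cellProb D a c ^ (2 * β - 1)) - Matrix.vecMulVec (fun c => cellProb D a c ^ β)
        (fun c => cellProb D a c ^ β)) *ᵥ y) := by
    rw [matSigma, matK, ← Matrix.mulVec_mulVec, ← Matrix.mulVec_mulVec, ← hw,
      Matrix.dotProduct_mulVec, ← Matrix.mulVec_transpose, hJt, ← hw, ← Matrix.mulVec_mulVec,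
      ← Matrix.mulVec_mulVec, ← hy, Matrix.dotProduct_mulVec, Matrix.vecMul_transpose]
  rw [h1, Matrix.sub_mulVec, dotProduct_sub]
  have hpos := cellProb_pos hR D a
  congr 1
  · simp only [dotProduct, Matrix.mulVec_diagonal, hinf]
    refine Finset.sum_congr rfl fun c _ => ?_
    have : cellProb D a c ^ (2 * β - 1) = (cellProb D a c ^ (β - 1)) ^ 2 * cellProb D a c := by
      rw [← Real.rpow_natCast, ← Real.rpow_mul (hpos c).le, ← Real.rpow_add_one (hpos c).ne']
      congr 1
      push_cast
      ring
    rw [this]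
    ring
  · have h2 : influence D β a u ⬝ᵥ cellProb D a = (fun c => cellProb D a c ^ β) ⬝ᵥ y := by
      simp only [dotProduct, hinf]
      refine Finset.sum_congr rfl fun c _ => ?_
      rw [mul_right_comm, ← Real.rpow_add_one (hpos c).ne', sub_add_cancel]
    rw [h2, Matrix.vecMulVec_mulVec, sq]
    simp [dotProduct_comm y]

/-- Slutsky's lemma: the central limit theorem for the linear term and the negligible remainder. -/
theorem deltaNormal_mdpde (hR : 1 ≤ R) {β : ℝ} (hβ : 0 ≤ β)
    (hTmeas : ∀ k j, Measurable (T k j))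
    (hTindep : iIndepFun (fun (kj : ℕ × Fin R) => T kj.1 kj.2) μ)
    (hTlaw : ∀ k j t, μ.real {ω | T k j ω ≤ t} = causeCDF D a₀ j t)
    {est : ℕ → Ω → Param R} (hestmeas : ∀ N, AEMeasurable (est N) μ)
    (hest : ∀ N, ∀ᵐ ω ∂μ, AllObserved D (empirical D T N ω) →
      (∃ a, IsMDPDE D β (empirical D T N ω) a) → IsMDPDE D β (empirical D T N ω) (est N ω))
    {g : Param R → ℝ} (hgm : Measurable g) {G : Param R} (hg : HasGradientAt g G a₀) :
    DeltaNormal μ est (matSigma D β a₀) g G a₀ := by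
  refine ⟨hg, ?_⟩
  have hpart : HasPartials g (⇑G) a₀ := hg
  set V := Var[fun ω => score D (influence D β a₀ ⇑G) fun j => T 0 j ω; μ] with hV
  have hVeq : V = ⇑G ⬝ᵥ (matSigma D β a₀ *ᵥ ⇑G) := by
    rw [hV, variance_score hR (hTmeas 0) (hTlaw 0) (iIndepFun_unit hTindep 0),
      variance_influence hR]
  -- The limit variance is nonnegative because it is the variance of a score, so semidefiniteness of
  -- K need not be proved separately; `V = 0` gives the Dirac mass.
  refine ⟨V.toNNReal, ?_, ?_⟩
  · rw [Real.coe_toNNReal _ (variance_nonneg _ _)]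
    exact hVeq
  · exact tendstoInDistribution_of_tendstoInMeasure_sub _ _
      (tendstoInDistribution_empirical hTmeas hTindep hTlaw (influence D β a₀ ⇑G))
      (tendstoInMeasure_remainder hR hβ hTmeas hTindep hTlaw hest hpart)
      (fun N => ((hgm.comp_aemeasurable (hestmeas N)).sub_const _).const_mul _)

end Sample

end Asymptotics

/-! ### Mean, reliability and quantile of the lifetimes, and their gradients. -/

section Characteristics

variable {L R : ℕ}

/-! ### Characteristics of exponential lifetimes -/

/-- A probability measure with exponential tails of rate `r` has the characteristics of the
exponential distribution. -/
lemma hasCharacteristics_of_tail {P : Measure ℝ} [IsProbabilityMeasure P] {r : ℝ} (hr : 0 < r)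
    (hP : ∀ x, P.real (Set.Ioi x) = Real.exp (-(r * max x 0))) {t0 α0 : ℝ} (ht0 : 0 ≤ t0)
    (hα0 : 0 < α0) (hα1 : α0 < 1) :
    HasCharacteristics P t0 α0 r⁻¹ (Real.exp (-t0 * r)) (-Real.log (1 - α0) / r) := by
  have hIic : ∀ x, P.real (Set.Iic x) = 1 - Real.exp (-(r * max x 0)) := by
    intro x
    rw [← hP x, ← Set.compl_Ioi, probReal_compl_eq_one_sub measurableSet_Ioi]
  have hnn : 0 ≤ᵐ[P] fun t : ℝ => t := by
    have h0 : P.real (Set.Iic 0) = 0 := by simp [hIic]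
    rw [measureReal_eq_zero_iff] at h0
    filter_upwards [measure_eq_zero_iff_ae_notMem.1 h0] with t ht
    exact (not_le.1 ht).le
  -- Layer-cake formula: the mean of a nonnegative variable is the integral of its tail. This also
  -- yields integrability.
  have hlin : ∫⁻ t, ENNReal.ofReal t ∂P = ENNReal.ofReal r⁻¹ := by
    rw [lintegral_eq_lintegral_meas_lt P hnn aemeasurable_id']
    have h1 : ∀ t ∈ Set.Ioi (0 : ℝ), P {a | t < a} = ENNReal.ofReal (Real.exp (-r * t)) := by
      intro t ht
      have h2 := hP t
      rw [max_eq_left (le_of_lt ht)] at h2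
      rw [← ENNReal.ofReal_toReal (measure_ne_top P _), neg_mul, ← h2]
      rfl
    rw [setLIntegral_congr_fun measurableSet_Ioi h1, ← ofReal_integral_eq_lintegral_ofReal
      (integrableOn_exp_mul_Ioi (neg_lt_zero.2 hr) 0)
      (Eventually.of_forall fun _ => (Real.exp_pos _).le), integral_exp_mul_Ioi (neg_lt_zero.2 hr)]
    congr 1
    simp [neg_div_neg_eq]
  have hint : Integrable (fun t : ℝ => t) P := by
    refine ⟨measurable_id.aestronglyMeasurable, ?_⟩
    rw [hasFiniteIntegral_iff_ofReal hnn, hlin]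
    exact ENNReal.ofReal_lt_top
  refine ⟨inferInstance, hint, ?_, ?_, ?_⟩
  · rw [integral_eq_lintegral_of_nonneg_ae hnn measurable_id.aestronglyMeasurable, hlin,
      ENNReal.toReal_ofReal (inv_pos.2 hr).le]
  · rw [hP, max_eq_left ht0]
    ring_nf
  · have hlog : Real.log (1 - α0) < 0 := Real.log_neg (by linarith) (by linarith)
    have hq : 0 < -Real.log (1 - α0) / r := div_pos (neg_pos.2 hlog) hr
    constructor
    · rw [Set.mem_ofPred_eq, hIic, max_eq_left hq.le, mul_div_cancel₀ _ hr.ne', neg_neg,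
        Real.exp_log (by linarith)]
      linarith
    · intro t ht
      rw [Set.mem_ofPred_eq, hIic] at ht
      have h1 : -(r * max t 0) ≤ Real.log (1 - α0) := by
        rw [Real.le_log_iff_exp_le (by linarith)]
        linarith
      have h2 : -Real.log (1 - α0) / r ≤ max t 0 := by
        rw [div_le_iff₀ hr]
        linarith
      rcases le_max_iff.1 h2 with h | h
      · exact h
      · exact absurd h (not_le.2 hq)

lemma expMeasure_real_Ioi {r : ℝ} (hr : 0 < r) (x : ℝ) :
    (expMeasure r).real (Set.Ioi x) = Real.exp (-(r * max x 0)) := by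
  have := isProbabilityMeasure_expMeasure hr
  rw [← Set.compl_Iic, probReal_compl_eq_one_sub measurableSet_Iic, ← cdf_eq_real,
    cdf_expMeasure_eq hr]
  split_ifs with h
  · rw [max_eq_left h]; ring
  · rw [max_eq_right (not_le.1 h).le]; simp

lemma isProbabilityMeasure_lifetimeLaw (x0 : ℝ) (a : Param R) :
    IsProbabilityMeasure (lifetimeLaw x0 a) := by
  have := fun j => isProbabilityMeasure_expMeasure (rate_pos a x0 j)
  exact Measure.isProbabilityMeasure_map
    (Measurable.iInf fun j => measurable_pi_apply j).aemeasurable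

/-- The infimum of a finite nonempty family is attained, so it exceeds `x` exactly when every
lifetime does; the exponential tails multiply and the rates add. -/
lemma lifetimeLaw_real_Ioi (hR : 1 ≤ R) (x0 : ℝ) (a : Param R) (x : ℝ) :
    (lifetimeLaw x0 a).real (Set.Ioi x) = Real.exp (-((∑ j, rate a x0 j) * max x 0)) := by
  have hp := fun j => isProbabilityMeasure_expMeasure (rate_pos a x0 j)
  have hne : Nonempty (Fin R) := ⟨⟨0, hR⟩⟩
  have hset : (fun t : Fin R → ℝ => ⨅ j, t j) ⁻¹' Set.Ioi x =
      Set.univ.pi fun _ => Set.Ioi x := by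
    ext t
    simp only [Set.mem_preimage, Set.mem_Ioi, Set.mem_univ_pi]
    refine ⟨fun h j => h.trans_le (ciInf_le (Set.finite_range t).bddBelow j), fun h => ?_⟩
    obtain ⟨j, hj⟩ := exists_eq_ciInf_of_finite (f := t)
    exact hj ▸ h j
  rw [lifetimeLaw, map_measureReal_apply (Measurable.iInf fun j => measurable_pi_apply j)
    measurableSet_Ioi, hset, measureReal_def, Measure.pi_pi, ENNReal.toReal_prod]
  simp only [← measureReal_def, expMeasure_real_Ioi (rate_pos a x0 _)]
  rw [← Real.exp_sum, Finset.sum_neg_distrib, Finset.sum_mul]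

lemma hasCharacteristics_lifetimeLaw (hR : 1 ≤ R) (x0 : ℝ) {t0 α0 : ℝ} (ht0 : 0 ≤ t0)
    (hα0 : 0 < α0) (hα1 : α0 < 1) (a : Param R) :
    HasCharacteristics (lifetimeLaw x0 a) t0 α0
      (meanLife x0 a) (reliability x0 t0 a) (quantile x0 α0 a) := by
  have := isProbabilityMeasure_lifetimeLaw x0 a
  exact hasCharacteristics_of_tail (sum_rate_pos hR a x0) (lifetimeLaw_real_Ioi hR x0 a)
    ht0 hα0 hα1

lemma causeMean_eq (x0 : ℝ) (j : Fin R) (a : Param R) : causeMean x0 j a = (rate a x0 j)⁻¹ :=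
  scale_eq_inv_rate a x0 j

lemma hasCharacteristics_expMeasure (x0 : ℝ) {t0 α0 : ℝ} (ht0 : 0 ≤ t0)
    (hα0 : 0 < α0) (hα1 : α0 < 1) (a : Param R) (j : Fin R) :
    HasCharacteristics (expMeasure (rate a x0 j)) t0 α0
      (causeMean x0 j a) (causeReliability x0 t0 j a) (causeQuantile x0 α0 j a) := by
  have hr := rate_pos a x0 j
  have := isProbabilityMeasure_expMeasure hr
  have h := hasCharacteristics_of_tail hr (expMeasure_real_Ioi hr) ht0 hα0 hα1
  rw [div_eq_mul_inv, ← causeMean_eq] at h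
  exact h

/-! ### Gradients of the characteristics -/

lemma hasPartials_meanLife (hR : 1 ≤ R) (x0 : ℝ) (a : Param R) :
    HasPartials (meanLife x0) (⇑(gradMean x0 a)) a := by
  refine ((hasPartials_sum_rate a x0).inv (sum_rate_pos hR a x0).ne').congr_partials fun k => ?_
  have := (sum_rate_pos hR a x0).ne'
  simp only [gradMean, relRisk]
  field_simp

lemma hasPartials_reliability (x0 t0 : ℝ) (a : Param R) :
    HasPartials (reliability x0 t0) (⇑(gradReliability x0 t0 a)) a := by
  refine ((hasPartials_sum_rate a x0).const_mul (-t0)).exp.congr_partials fun k => ?_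
  simp only [gradReliability, reliability]
  ring

lemma hasPartials_quantile (hR : 1 ≤ R) (x0 α0 : ℝ) (a : Param R) :
    HasPartials (quantile x0 α0) (⇑(gradQuantile x0 α0 a)) a := by
  refine ((hasPartials_meanLife hR x0 a).const_mul (-Real.log (1 - α0))).congr_partials fun k => ?_
  simp only [gradQuantile, gradMean]
  ring

lemma hasPartials_causeMean (x0 : ℝ) (j : Fin R) (a : Param R) :
    HasPartials (causeMean x0 j) (⇑(blockVec x0 j (causeMean x0 j a))) a := by
  have hr := (rate_pos a x0 j).ne'
  rw [funext (causeMean_eq x0 j)]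
  refine ((hasPartials_rate a x0 j).inv hr).congr_partials fun k => ?_
  simp only [blockVec]
  split_ifs
  · field_simp
  · simp

lemma hasPartials_causeReliability (x0 t0 : ℝ) (j : Fin R) (a : Param R) :
    HasPartials (causeReliability x0 t0 j)
      (⇑(blockVec x0 j (causeReliability x0 t0 j a * t0 * rate a x0 j))) a := by
  refine ((hasPartials_rate a x0 j).const_mul (-t0)).exp.congr_partials fun k => ?_
  simp only [blockVec, causeReliability, rate]
  split_ifs
  · ring
  · simp

lemma hasPartials_causeQuantile (x0 α0 : ℝ) (j : Fin R) (a : Param R) :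
    HasPartials (causeQuantile x0 α0 j) (⇑(blockVec x0 j (causeQuantile x0 α0 j a))) a := by
  refine ((hasPartials_causeMean x0 j a).const_mul (-Real.log (1 - α0))).congr_partials fun k => ?_
  simp only [blockVec, causeQuantile, causeMean]
  split_ifs
  · ring
  · simp

/-- The gradient formulas are proved at every parameter, not only at the true one, so that each
characteristic is continuous and its plug-in estimator measurable. -/
lemma measurable_of_hasPartials {g : Param R → ℝ} {G : Param R → Param R}
    (hg : ∀ a, HasPartials g (⇑(G a)) a) : Measurable g :=
  (continuous_iff_continuousAt.2 fun a => (hg a).continuousAt).measurable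

lemma blockVec_dotProduct_mulVec (S : Matrix (Fin R × Fin 2) (Fin R × Fin 2) ℝ) (x0 : ℝ)
    (j : Fin R) (c : ℝ) :
    ⇑(blockVec x0 j c) ⬝ᵥ (S *ᵥ ⇑(blockVec x0 j c)) = c ^ 2 * blockForm (block S j) x0 := by
  simp only [blockVec, blockForm, block, dotProduct, Matrix.mulVec, Fintype.sum_prod_type,
    Fin.sum_univ_two, mul_ite, mul_zero, ite_mul, zero_mul, Matrix.submatrix_apply]
  simp [Finset.sum_add_distrib]
  ring

end Characteristics

end StepStress

end

open StepStress in
theorem mainTheorem2 {L R : ℕ} (hR : 1 ≤ R) (D : Plan L)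
    (a₀ : Param R) (β : ℝ) (hβ : 0 ≤ β)
    {Ω : Type*} [MeasurableSpace Ω] (μ : Measure Ω) [IsProbabilityMeasure μ]
    (T : ℕ → Fin R → Ω → ℝ) (hTmeas : ∀ k j, Measurable (T k j))
    (hTindep : iIndepFun (fun (kj : ℕ × Fin R) => T kj.1 kj.2) μ)
    (hTlaw : ∀ k j t, μ.real {ω | T k j ω ≤ t} = causeCDF D a₀ j t)
    (est : ℕ → Ω → Param R) (hestmeas : ∀ N, AEMeasurable (est N) μ)
    (hest : ∀ N, ∀ᵐ ω ∂μ, AllObserved D (empirical D T N ω) →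
      (∃ a, IsMDPDE D β (empirical D T N ω) a) → IsMDPDE D β (empirical D T N ω) (est N ω))
    (x0 t0 α0 : ℝ) (ht0 : 0 ≤ t0) (hα0 : 0 < α0) (hα1 : α0 < 1) :
    (∀ a : Param R,
      HasCharacteristics (lifetimeLaw x0 a) t0 α0
        (meanLife x0 a) (reliability x0 t0 a) (quantile x0 α0 a) ∧
      ∀ j, HasCharacteristics (expMeasure (rate a x0 j)) t0 α0
        (causeMean x0 j a) (causeReliability x0 t0 j a) (causeQuantile x0 α0 j a)) ∧
    IsUnit (matJ D β a₀).det ∧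
    DeltaNormal μ est (matSigma D β a₀) (meanLife x0) (gradMean x0 a₀) a₀ ∧
    DeltaNormal μ est (matSigma D β a₀) (reliability x0 t0) (gradReliability x0 t0 a₀) a₀ ∧
    DeltaNormal μ est (matSigma D β a₀) (quantile x0 α0) (gradQuantile x0 α0 a₀) a₀ ∧
    ∀ j : Fin R,
      (DeltaNormal μ est (matSigma D β a₀) (causeMean x0 j)
          (blockVec x0 j (causeMean x0 j a₀)) a₀ ∧
        AsympNormal μ (fun N ω => causeMean x0 j (est N ω)) (causeMean x0 j a₀)
          (causeMean x0 j a₀ ^ 2 * blockForm (block (matSigma D β a₀) j) x0)) ∧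
      (DeltaNormal μ est (matSigma D β a₀) (causeReliability x0 t0 j)
          (blockVec x0 j (causeReliability x0 t0 j a₀ * t0 * rate a₀ x0 j)) a₀ ∧
        AsympNormal μ (fun N ω => causeReliability x0 t0 j (est N ω)) (causeReliability x0 t0 j a₀)
          (causeReliability x0 t0 j a₀ ^ 2 * t0 ^ 2 * Real.exp (-2 * a₀ (j, 0) - 2 * a₀ (j, 1) * x0)
            * blockForm (block (matSigma D β a₀) j) x0)) ∧
      (DeltaNormal μ est (matSigma D β a₀) (causeQuantile x0 α0 j)
          (blockVec x0 j (causeQuantile x0 α0 j a₀)) a₀ ∧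
        AsympNormal μ (fun N ω => causeQuantile x0 α0 j (est N ω)) (causeQuantile x0 α0 j a₀)
          (causeQuantile x0 α0 j a₀ ^ 2 * blockForm (block (matSigma D β a₀) j) x0)) := by
  have key : ∀ {g : Param R → ℝ} {G : Param R → Param R}, (∀ a, HasPartials g (⇑(G a)) a) →
      DeltaNormal μ est (matSigma D β a₀) g (G a₀) a₀ := fun hg =>
    deltaNormal_mdpde hR hβ hTmeas hTindep hTlaw hestmeas hest (measurable_of_hasPartials hg)
      (hg a₀)
  refine ⟨fun a => ⟨hasCharacteristics_lifetimeLaw hR x0 ht0 hα0 hα1 a,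
    hasCharacteristics_expMeasure x0 ht0 hα0 hα1 a⟩, isUnit_det_matJ hR D β a₀,
    key (hasPartials_meanLife hR x0), key (hasPartials_reliability x0 t0),
    key (hasPartials_quantile hR x0 α0), fun j => ?_⟩
  have h1 := key (hasPartials_causeMean x0 j)
  have h2 := key (hasPartials_causeReliability x0 t0 j)
  have h3 := key (hasPartials_causeQuantile x0 α0 j)
  refine ⟨⟨h1, ?_⟩, ⟨h2, ?_⟩, ⟨h3, ?_⟩⟩
  · rw [← blockVec_dotProduct_mulVec]
    exact h1.2
  · have he : Real.exp (-2 * a₀ (j, 0) - 2 * a₀ (j, 1) * x0) = rate a₀ x0 j ^ 2 := by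
      rw [rate, ← Real.exp_nat_mul]
      push_cast
      ring_nf
    rw [he, ← mul_pow, ← mul_pow, ← blockVec_dotProduct_mulVec]
    exact h2.2
  · rw [← blockVec_dotProduct_mulVec]
    exact h3.2
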